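/- A temporal graph $\mathcal G=(G_1,\dots,G_T)$, $T\ge 1$, is a sequence of (simple, finite) graphs on a common set $V$ of $n$ vertices. For $i\in[T]$ let $$F_i=\{v\in V:\ \exists\,p,q\in[T],\ p\le i\le q,\ \deg_{G_p}(v)\ge 1,\ \deg_{G_q}(v)\ge 1\},$$ and let $\mathrm{vimw}(\mathcal G)=\max_{i\in[T]}|F_i|$ be the vertex-interval-membership-width. A $k$-activity $\ell$-timeline is a set $\mathcal T$ of triples $(v,a,b)\in V\times[T]\times[T]$ with $a\le b$ and $b-a\le \ell$ that contains at most $k$ triples for each vertex $v$. A vertex $u$ is active at time $i$ if $a\le i\le b$ for some $(u,a,b)\in\mathcal T$, and $\mathcal T$ dominates the temporal vertex $(v,i)\in V\times[T]$ if $v$ or one of its neighbors in $G_i$ is active at time $i$. Timeline Partial Dominating Set: given $\mathcal G$ and integers $k\ge 1$, $\ell\ge 0$, $t\ge 0$, is there a $k$-activity $\ell$-timeline that dominates at least $t$ temporal vertices? Timeline Dominating Set: given $\mathcal G$ and integers $k\ge 1$, $\ell\ge 0$, is there a $k$-activity $\ell$-timeline that dominates all temporal vertices? **Theorem.** Timeline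 Partial Dominating Set is solvable in $\big((k+1)(\ell+2)\big)^{2\cdot\mathrm{vimw}(\mathcal G)}\cdot(n+T)^{O(1)}$ time, and so is Timeline Dominating Set. Here, time is the number of steps of a word RAM that gets $n,T,k,\ell$ (and $t$) as single words and the snapshots as adjacency matrices. More precisely, for each of the two problems there are a program and a constant $c$ such that the program decides every instance within $c\cdot\big((k+1)(\ell+2)\big)^{2\cdot\mathrm{vimw}(\mathcal G)}\cdot(n+T)^{c}$ steps, for every word length $w$ with $2^w\ge N^c$, where $N=n+T+k+\ell+t+\big((k+1)(\ell+2)\big)^{2\cdot\mathrm{vimw}(\mathcal G)}$ (without the term $t$ for Timeline Dominating Set). -/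

import Mathlib

/-! ## Temporal graphs and timelines -/

/-- A temporal graph with vertex set `V` and lifetime `T`: a sequence of `T` graphs (the snapshots)
on the same vertex set. The time steps `1, …, T` are represented by the elements of `Fin T`. -/
abbrev TemporalGraph (V : Type*) (T : ℕ) := Fin T → SimpleGraph V

namespace TemporalGraph

variable {V : Type*} {T : ℕ}

open Classical in
/-- The bag `F_i` of the vertex-interval-membership sequence: the vertices that are non-isolated in
some snapshot at a time `p ≤ i` and in some snapshot at a time `q ≥ i`. -/
noncomputable def bag [Fintype V] (𝒢 : TemporalGraph V T) (i : Fin T) : Finset V :=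
  {v | ∃ p q : Fin T, p ≤ i ∧ i ≤ q ∧ 1 ≤ (𝒢 p).degree v ∧ 1 ≤ (𝒢 q).degree v}

/-- The vertex-interval-membership-width: the maximum size of a bag. -/
noncomputable def vimw [Fintype V] (𝒢 : TemporalGraph V T) : ℕ :=
  Finset.univ.sup fun i : Fin T => (bag 𝒢 i).card

open Classical in
/-- `𝒯` is a `k`-activity `ℓ`-timeline: a set of activity intervals `(v, a, b)` with `a ≤ b`,
each of length `b - a` at most `ℓ`, and at most `k` of them for each vertex `v`. -/
def IsTimeline (k ℓ : ℕ) (𝒯 : Finset (V × Fin T × Fin T)) : Prop :=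
  (∀ v a b, (v, a, b) ∈ 𝒯 → a ≤ b ∧ (b : ℕ) - (a : ℕ) ≤ ℓ) ∧
  ∀ v, (𝒯.filter fun x => x.1 = v).card ≤ k

/-- The vertex `v` is active in snapshot `i`. -/
def IsActive (𝒯 : Finset (V × Fin T × Fin T)) (v : V) (i : Fin T) : Prop :=
  ∃ a b, (v, a, b) ∈ 𝒯 ∧ a ≤ i ∧ i ≤ b

/-- The temporal vertex `(v, i)` is dominated: `v` lies in the closed neighborhood, in snapshot `i`,
of the set of vertices that are active in snapshot `i`. -/
def Dominates (𝒢 : TemporalGraph V T) (𝒯 : Finset (V × Fin T × Fin T)) (v : V) (i : Fin T) : Prop :=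
  ∃ u, IsActive 𝒯 u i ∧ (v = u ∨ (𝒢 i).Adj u v)

open Classical in
/-- Timeline Partial Dominating Set: some `k`-activity `ℓ`-timeline dominates at least `t` temporal
vertices. -/
def TimelinePDS [Fintype V] (𝒢 : TemporalGraph V T) (k ℓ t : ℕ) : Prop :=
  ∃ 𝒯 : Finset (V × Fin T × Fin T), IsTimeline k ℓ 𝒯 ∧
    t ≤ (Finset.univ.filter fun x : V × Fin T => Dominates 𝒢 𝒯 x.1 x.2).card

/-- Timeline Dominating Set: some `k`-activity `ℓ`-timeline dominates all temporal vertices. -/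
def TimelineDS (𝒢 : TemporalGraph V T) (k ℓ : ℕ) : Prop :=
  ∃ 𝒯 : Finset (V × Fin T × Fin T), IsTimeline k ℓ 𝒯 ∧ ∀ v i, Dominates 𝒢 𝒯 v i

/-! ## Instances as input for a machine -/

open Classical in
/-- The adjacency matrices of the snapshots, one after the other, each of them row by row: the entry
at position `(i * n + u) * n + v` is `1` if `uv` is an edge of snapshot `i`, and `0` otherwise. -/
noncomputable def adjacencyList {n T : ℕ} (𝒢 : TemporalGraph (Fin n) T) : List ℕ :=
  List.ofFn fun j : Fin (T * n * n) =>
    if (𝒢 j.divNat.divNat).Adj j.divNat.modNat j.modNat then 1 else 0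

/-- An instance `(𝒢, k, ℓ)` of Timeline Dominating Set as a list of numbers. -/
noncomputable def encodeDS {n T : ℕ} (𝒢 : TemporalGraph (Fin n) T) (k ℓ : ℕ) : List ℕ :=
  [n, T, k, ℓ] ++ adjacencyList 𝒢

/-- An instance `(𝒢, k, ℓ, t)` of Timeline Partial Dominating Set as a list of numbers. -/
noncomputable def encodePDS {n T : ℕ} (𝒢 : TemporalGraph (Fin n) T) (k ℓ t : ℕ) : List ℕ :=
  [n, T, k, ℓ] ++ adjacencyList 𝒢 ++ [t]

end TemporalGraph

/-! ## The word RAM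

A word RAM with words of `w` bits. Its state consists of registers and a random-access memory, all
of whose cells hold numbers below `2 ^ w`. Programs are finite, do not depend on `w`, and are written
with sequencing, branching and while-loops. Every operation, every memory access, every test and
every command costs one step. -/

namespace WordRAM

/-- The arithmetic and comparison operations of the machine. -/
inductive Op
  | add | sub | mul | div | mod | lt | eq

/-- Addition and multiplication are modulo `2 ^ w`; subtraction is cut off at `0`; `x / 0 = 0` and
`x mod 0 = x`; comparisons return `1` (true) or `0` (false), which for `w = 0` are both `0`. -/
def Op.apply (w : ℕ) : Op → ℕ → ℕ → ℕ
  | add, x, y => (x + y) % 2 ^ w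
  | sub, x, y => x - y
  | mul, x, y => (x * y) % 2 ^ w
  | div, x, y => x / y
  | mod, x, y => x % y
  | lt, x, y => (if x < y then 1 else 0) % 2 ^ w
  | eq, x, y => (if x = y then 1 else 0) % 2 ^ w

/-- Expressions: constants, registers, memory cells at a computed address, and operations. -/
inductive Expr
  | const (m : ℕ)
  | reg (r : ℕ)
  | load (addr : Expr)
  | bin (op : Op) (e₁ e₂ : Expr)

/-- Programs. -/
inductive Program
  /-- do nothing -/
  | skip
  /-- write the value of an expression into register `r` -/
  | assign (r : ℕ) (e : Expr)
  /-- write the value of `e` into the memory cell whose address is the value of `addr` -/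
  | store (addr e : Expr)
  /-- first `P`, then `Q` -/
  | seq (P Q : Program)
  /-- `P` if the value of `e` is nonzero, otherwise `Q` -/
  | ite (e : Expr) (P Q : Program)
  /-- repeat `P` as long as the value of `e` is nonzero -/
  | loop (e : Expr) (P : Program)

/-- The contents of the registers and of the memory. -/
structure State where
  reg : ℕ → ℕ
  mem : ℕ → ℕ

/-- The value of an expression on the machine with `w`-bit words. -/
def Expr.eval (w : ℕ) (s : State) : Expr → ℕ
  | const m => m % 2 ^ w
  | reg r => s.reg r
  | load addr => s.mem (addr.eval w s)
  | bin op e₁ e₂ => op.apply w (e₁.eval w s) (e₂.eval w s)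

/-- The number of steps for the evaluation of an expression. -/
def Expr.cost : Expr → ℕ
  | const _ => 1
  | reg _ => 1
  | load addr => addr.cost + 1
  | bin _ e₁ e₂ => e₁.cost + e₂.cost + 1

/-- `Exec w P s s' m`: on the machine with `w`-bit words, the program `P`, started in the state `s`,
halts in the state `s'` after exactly `m` steps. -/
inductive Exec (w : ℕ) : Program → State → State → ℕ → Prop
  | skip (s : State) : Exec w .skip s s 1
  | assign (s : State) (r : ℕ) (e : Expr) :
      Exec w (.assign r e) s { s with reg := Function.update s.reg r (e.eval w s) } (e.cost + 1)
  | store (s : State) (addr e : Expr) :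
      Exec w (.store addr e) s
        { s with mem := Function.update s.mem (addr.eval w s) (e.eval w s) }
        (addr.cost + e.cost + 1)
  | seq {P Q : Program} {s s' s'' : State} {m m' : ℕ} :
      Exec w P s s' m → Exec w Q s' s'' m' → Exec w (.seq P Q) s s'' (m + m')
  | ite_true {e : Expr} {P Q : Program} {s s' : State} {m : ℕ} :
      e.eval w s ≠ 0 → Exec w P s s' m → Exec w (.ite e P Q) s s' (e.cost + 1 + m)
  | ite_false {e : Expr} {P Q : Program} {s s' : State} {m : ℕ} :
      e.eval w s = 0 → Exec w Q s s' m → Exec w (.ite e P Q) s s' (e.cost + 1 + m)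
  | loop_done {e : Expr} {P : Program} {s : State} :
      e.eval w s = 0 → Exec w (.loop e P) s s (e.cost + 1)
  | loop_step {e : Expr} {P : Program} {s s' s'' : State} {m m' : ℕ} :
      e.eval w s ≠ 0 → Exec w P s s' m → Exec w (.loop e P) s' s'' m' →
      Exec w (.loop e P) s s'' (e.cost + 1 + m + m')

/-- The initial state: the input is in the memory cells `0, 1, 2, …`, all else is `0`. -/
def initState (w : ℕ) (input : List ℕ) : State where
  reg := fun _ => 0
  mem := fun a => input.getD a 0 % 2 ^ w

/-- On the machine with `w`-bit words, `P` halts on the given input after at most `b` steps, and it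
accepts (register `0` holds `1` at the end) if and only if the answer is `yes`. -/
def DecidesWithin (w : ℕ) (P : Program) (input : List ℕ) (b : ℕ) (yes : Prop) : Prop :=
  ∃ (s : State) (m : ℕ), Exec w P (initState w input) s m ∧ m ≤ b ∧ (s.reg 0 = 1 ↔ yes)

end WordRAM

/-! For a single vertex, all that matters about its triples is the set of its active times. Such a
set can be covered by `k` intervals of at most `ℓ + 1` consecutive times exactly if a greedy account
never runs dry: start with `k (ℓ + 1)` units in blocks of `ℓ + 1`, pay one unit per active time, and
at an inactive time forfeit what is left of the opened block. The two directions are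
`feasible_of_intervals` and `Feasible.exists_starts`. Thus the whole past of a vertex is summarized
by one number, its budget.

The times at which a vertex lies in the bag form an interval `[s, e]`. At other times it is
isolated, so it dominates only itself and is dominated only by itself. If its budget at time `s` is
`μ`, the best possible contribution before `s` is `min s (M - μ)` with `M = k (ℓ + 1)`; after `e` it
is the minimum of the number of remaining times and the remaining budget. Both values are attained
by packing the activity next to `[s, e]`. Hence a dynamic program over time need only remember the
budgets of vertices shared by consecutive bags. A configuration at time `i` gives each bag vertex a
budget and an activity bit, that is, one of `2 (M + 1) ≤ ((k + 1) (ℓ + 2)) ^ 2` values, which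
explains the factor `2` in the exponent. It determines the code of the budgets it receives
(`source`), the code of those it hands on (`target`), and a gain. `vertexScore_le` and
`IsPath.exists_activity` show that paths of compatible configurations achieve the same optimum as
feasible activities; `lt_table_iff_exists_activity` and `timelinePDS_iff_lt_table` conclude.
Complete domination is the case `t = n T` of partial domination.

For the running time, configurations are numbered in a mixed radix system, and the program loops
over them once per time step, each of them updating a single table entry. There is no loop over
pairs of configurations, so the exponential factor occurs only once. Everything evaluated per
configuration is a term with iterations of at most `n + T` rounds. `Tm.compile` turns such terms
into programs, `Ev` states their correctness together with the time bound, and `Tm.cost_le` makes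
that bound polynomial. Since `w` is logarithmically large, no intermediate value overflows (`Fits`).
-/

namespace WordRAM

/-! ## Terms with bounded iteration -/

/-- Side-effect free terms with bounded iteration. Variables are de Bruijn indices. -/
inductive Tm
  | const (m : ℕ)
  | var (i : ℕ)
  | load (a : Tm)
  | bin (o : Op) (a b : Tm)
  | ite (c a b : Tm)
  /-- start with `init` and combine it by `o` with the values of `body` for the indices below
  `bound` -/
  | fold (o : Op) (init : ℕ) (bound body : Tm)

/-- Prepend a value to an environment. -/
def scons (x : ℕ) (f : ℕ → ℕ) : ℕ → ℕ
  | 0 => x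
  | i + 1 => f i

@[simp] theorem scons_zero (x : ℕ) (f : ℕ → ℕ) : scons x f 0 = x := rfl

@[simp] theorem scons_succ (x : ℕ) (f : ℕ → ℕ) (i : ℕ) : scons x f (i + 1) = f i := rfl

/-- The program that computes a term into register `d`. It changes only registers from `d` on; the
variable `i` is found in register `ρ i`. -/
def Tm.compile : (ℕ → ℕ) → ℕ → Tm → Program
  | _, d, .const m => .assign d (.const m)
  | ρ, d, .var i => .assign d (.reg (ρ i))
  | ρ, d, .load a => .seq (a.compile ρ d) (.assign d (.load (.reg d)))
  | ρ, d, .bin o a b =>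
    .seq (a.compile ρ d) (.seq (b.compile ρ (d + 1)) (.assign d (.bin o (.reg d) (.reg (d + 1)))))
  | ρ, d, .ite c a b => .seq (c.compile ρ d) (.ite (.reg d) (a.compile ρ d) (b.compile ρ d))
  | ρ, d, .fold o init bound body =>
    .seq (bound.compile ρ d) (.seq (.assign (d + 1) (.const init)) (.seq (.assign (d + 2) (.const 0))
      (.seq
        (.loop (.bin .lt (.reg (d + 2)) (.reg d))
          (.seq (body.compile (scons (d + 2) ρ) (d + 3))
            (.seq (.assign (d + 1) (.bin o (.reg (d + 1)) (.reg (d + 3))))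
              (.assign (d + 2) (.bin .add (.reg (d + 2)) (.const 1))))))
        (.assign d (.reg (d + 1))))))

/-- An upper bound on the running time of a compiled term all of whose iterations have at most `R`
rounds. -/
def Tm.cost (R : ℕ) : Tm → ℕ
  | .const _ => 2
  | .var _ => 2
  | .load a => a.cost R + 3
  | .bin _ a b => a.cost R + b.cost R + 4
  | .ite c a b => c.cost R + 2 + a.cost R + b.cost R
  | .fold _ _ bound body => bound.cost R + (R * (body.cost R + 12) + 10)

/-- Using one constant as both factor and exponent gives a class of bounds closed under sums and
under multiplication by `R`, which is all that nested iterations require. -/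
theorem polyBound_add {c₁ c₂ R a b : ℕ} (hR : 1 ≤ R) (ha : a ≤ c₁ * R ^ c₁) (hb : b ≤ c₂ * R ^ c₂) :
    a + b ≤ (c₁ + c₂) * R ^ (c₁ + c₂) := by
  have h₁ : R ^ c₁ ≤ R ^ (c₁ + c₂) := Nat.pow_le_pow_right hR (by omega)
  have h₂ : R ^ c₂ ≤ R ^ (c₁ + c₂) := Nat.pow_le_pow_right hR (by omega)
  calc a + b ≤ c₁ * R ^ (c₁ + c₂) + c₂ * R ^ (c₁ + c₂) :=
        add_le_add (ha.trans (Nat.mul_le_mul_left _ h₁)) (hb.trans (Nat.mul_le_mul_left _ h₂))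
    _ = _ := by ring

theorem polyBound_mono {c c' R a : ℕ} (hR : 1 ≤ R) (h : c ≤ c') (ha : a ≤ c * R ^ c) :
    a ≤ c' * R ^ c' :=
  ha.trans (Nat.mul_le_mul h (Nat.pow_le_pow_right hR h))

theorem polyBound_const {m R : ℕ} (hR : 1 ≤ R) : m ≤ m * R ^ m :=
  Nat.le_mul_of_pos_right _ (Nat.pow_pos hR)

theorem polyBound_mul {c R a : ℕ} (ha : a ≤ c * R ^ c) :
    R * a ≤ (c + 1) * R ^ (c + 1) := by
  calc R * a ≤ R * (c * R ^ c) := Nat.mul_le_mul_left _ ha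
    _ = c * R ^ (c + 1) := by ring
    _ ≤ _ := Nat.mul_le_mul_right _ (by omega)

theorem Tm.cost_le (e : Tm) : ∃ c, ∀ R, 1 ≤ R → e.cost R ≤ c * R ^ c := by
  induction e with
  | const m => exact ⟨2, fun R hR => polyBound_const hR⟩
  | var i => exact ⟨2, fun R hR => polyBound_const hR⟩
  | load a ha =>
    obtain ⟨c, hc⟩ := ha
    exact ⟨c + 3, fun R hR => polyBound_add hR (hc R hR) (polyBound_const hR)⟩
  | bin o a b ha hb =>
    obtain ⟨c, hc⟩ := ha
    obtain ⟨c', hc'⟩ := hb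
    exact ⟨c + c' + 4, fun R hR =>
      polyBound_add hR (polyBound_add hR (hc R hR) (hc' R hR)) (polyBound_const hR)⟩
  | ite e a b he ha hb =>
    obtain ⟨c₀, hc₀⟩ := he
    obtain ⟨c, hc⟩ := ha
    obtain ⟨c', hc'⟩ := hb
    exact ⟨c₀ + 2 + c + c', fun R hR =>
      polyBound_add hR (polyBound_add hR (polyBound_add hR (hc₀ R hR) (polyBound_const hR))
        (hc R hR)) (hc' R hR)⟩
  | fold o init a b ha hb =>
    obtain ⟨c, hc⟩ := ha
    obtain ⟨c', hc'⟩ := hb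
    exact ⟨c + ((c' + 12 + 1) + 10), fun R hR =>
      polyBound_add hR (hc R hR) (polyBound_add hR
        (polyBound_mul (polyBound_add hR (hc' R hR) (polyBound_const hR)))
        (polyBound_const hR))⟩

/-- The effect of `assign`. -/
def State.set (s : State) (r v : ℕ) : State := { s with reg := Function.update s.reg r v }

@[simp] theorem State.set_mem (s : State) (r v : ℕ) : (s.set r v).mem = s.mem := rfl

@[simp] theorem State.set_reg_self (s : State) (r v : ℕ) : (s.set r v).reg r = v := by
  simp [State.set]

theorem State.set_reg_ne (s : State) {r r' : ℕ} (v : ℕ) (h : r' ≠ r) :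
    (s.set r v).reg r' = s.reg r' := by
  simp [State.set, h]

theorem Exec.assign' {w : ℕ} {s : State} {r : ℕ} {e : Expr} {v : ℕ} (h : e.eval w s = v) :
    Exec w (.assign r e) s (s.set r v) (e.cost + 1) :=
  h ▸ Exec.assign s r e

/-- On the machine with `w`-bit words and memory contents `mem`, the compiled term `e` computes the
value `v` when its variables have the values `env`. -/
def Ev (w R : ℕ) (mem env : ℕ → ℕ) (e : Tm) (v : ℕ) : Prop :=
  ∀ (ρ : ℕ → ℕ) (d : ℕ) (s : State), (∀ i, ρ i < d) → s.mem = mem → (∀ i, s.reg (ρ i) = env i) →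
    ∃ s' m, Exec w (e.compile ρ d) s s' m ∧ m ≤ e.cost R ∧ s'.mem = mem ∧
      (∀ r < d, s'.reg r = s.reg r) ∧ s'.reg d = v

/-! ### Evaluation rules for compiled terms. -/

section Rules

variable {w R : ℕ} {mem env : ℕ → ℕ}

theorem Ev.const {m : ℕ} (hm : m < 2 ^ w) : Ev w R mem env (.const m) m := by
  intro ρ d s hρ hmem henv
  refine ⟨s.set d m, _, Exec.assign' (by simp [Expr.eval, Nat.mod_eq_of_lt hm]), le_rfl, by simpa,
    fun r hr => s.set_reg_ne _ hr.ne, by simp⟩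

theorem Ev.var (i : ℕ) : Ev w R mem env (.var i) (env i) := by
  intro ρ d s hρ hmem henv
  exact ⟨s.set d (env i), _, Exec.assign' (by simp [Expr.eval, henv]), le_rfl, by simpa,
    fun r hr => s.set_reg_ne _ hr.ne, by simp⟩

theorem Ev.load {a : Tm} {x : ℕ} (ha : Ev w R mem env a x) :
    Ev w R mem env (.load a) (mem x) := by
  intro ρ d s hρ hmem henv
  obtain ⟨s₁, m₁, h₁, hm₁, hmem₁, hr₁, hv₁⟩ := ha ρ d s hρ hmem henv
  refine ⟨s₁.set d (mem x), _, h₁.seq (Exec.assign' (by simp [Expr.eval, hv₁, hmem₁])), ?_,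
    by simpa, fun r hr => by rw [s₁.set_reg_ne _ hr.ne, hr₁ r hr], by simp⟩
  simp only [Expr.cost, Tm.cost]; omega

theorem Ev.bin {o : Op} {a b : Tm} {x y z : ℕ} (ha : Ev w R mem env a x) (hb : Ev w R mem env b y)
    (hz : o.apply w x y = z) : Ev w R mem env (.bin o a b) z := by
  intro ρ d s hρ hmem henv
  obtain ⟨s₁, m₁, h₁, hm₁, hmem₁, hr₁, hv₁⟩ := ha ρ d s hρ hmem henv
  obtain ⟨s₂, m₂, h₂, hm₂, hmem₂, hr₂, hv₂⟩ := hb ρ (d + 1) s₁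
    (fun i => (hρ i).trans d.lt_succ_self) hmem₁ (fun i => by rw [hr₁ _ (hρ i), henv i])
  refine ⟨s₂.set d z, _, h₁.seq (h₂.seq (Exec.assign' ?_)), ?_, by simpa,
    fun r hr => by rw [s₂.set_reg_ne _ hr.ne, hr₂ r (by omega), hr₁ r hr], by simp⟩
  · simp only [Expr.eval]
    rw [hv₂, hr₂ d d.lt_succ_self, hv₁, hz]
  · simp only [Expr.cost, Tm.cost]; omega

theorem Ev.add {a b : Tm} {x y : ℕ} (ha : Ev w R mem env a x) (hb : Ev w R mem env b y)
    (h : x + y < 2 ^ w) : Ev w R mem env (.bin .add a b) (x + y) :=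
  ha.bin hb (Nat.mod_eq_of_lt h)

theorem Ev.mul {a b : Tm} {x y : ℕ} (ha : Ev w R mem env a x) (hb : Ev w R mem env b y)
    (h : x * y < 2 ^ w) : Ev w R mem env (.bin .mul a b) (x * y) :=
  ha.bin hb (Nat.mod_eq_of_lt h)

theorem Ev.sub {a b : Tm} {x y : ℕ} (ha : Ev w R mem env a x) (hb : Ev w R mem env b y) :
    Ev w R mem env (.bin .sub a b) (x - y) :=
  ha.bin hb rfl

theorem Ev.div {a b : Tm} {x y : ℕ} (ha : Ev w R mem env a x) (hb : Ev w R mem env b y) :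
    Ev w R mem env (.bin .div a b) (x / y) :=
  ha.bin hb rfl

theorem Ev.mod {a b : Tm} {x y : ℕ} (ha : Ev w R mem env a x) (hb : Ev w R mem env b y) :
    Ev w R mem env (.bin .mod a b) (x % y) :=
  ha.bin hb rfl

theorem Ev.lt {a b : Tm} {x y : ℕ} (hw : 0 < w) (ha : Ev w R mem env a x)
    (hb : Ev w R mem env b y) : Ev w R mem env (.bin .lt a b) (if x < y then 1 else 0) :=
  ha.bin hb (Nat.mod_eq_of_lt (by have := Nat.one_lt_two_pow hw.ne'; split_ifs <;> omega))

theorem Ev.eq {a b : Tm} {x y : ℕ} (hw : 0 < w) (ha : Ev w R mem env a x)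
    (hb : Ev w R mem env b y) : Ev w R mem env (.bin .eq a b) (if x = y then 1 else 0) :=
  ha.bin hb (Nat.mod_eq_of_lt (by have := Nat.one_lt_two_pow hw.ne'; split_ifs <;> omega))

/-- Each branch is constrained only if it is taken, so overflow conditions may be proved under the
outcome of the test. -/
theorem Ev.ite {c a b : Tm} {x y : ℕ} (hc : Ev w R mem env c x)
    (ha : x ≠ 0 → Ev w R mem env a y) (hb : x = 0 → Ev w R mem env b y) :
    Ev w R mem env (.ite c a b) y := by
  intro ρ d s hρ hmem henv
  obtain ⟨s₁, m₁, h₁, hm₁, hmem₁, hr₁, hv₁⟩ := hc ρ d s hρ hmem henv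
  by_cases hx : x = 0
  · obtain ⟨s₂, m₂, h₂, hm₂, hmem₂, hr₂, hv₂⟩ := hb hx ρ d s₁ hρ hmem₁
      (fun i => by rw [hr₁ _ (hρ i), henv i])
    refine ⟨s₂, _, h₁.seq (Exec.ite_false (by simp [Expr.eval, hv₁, hx]) h₂), ?_, hmem₂,
      fun r hr => by rw [hr₂ r hr, hr₁ r hr], hv₂⟩
    simp only [Expr.cost, Tm.cost]; omega
  · obtain ⟨s₂, m₂, h₂, hm₂, hmem₂, hr₂, hv₂⟩ := ha hx ρ d s₁ hρ hmem₁
      (fun i => by rw [hr₁ _ (hρ i), henv i])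
    refine ⟨s₂, _, h₁.seq (Exec.ite_true (by simp [Expr.eval, hv₁, hx]) h₂), ?_, hmem₂,
      fun r hr => by rw [hr₂ r hr, hr₁ r hr], hv₂⟩
    simp only [Expr.cost, Tm.cost]; omega

/-- The rule for loops that count a register `j` up to the contents of a register `b`. -/
theorem exec_count {j b : ℕ} {P : Program} {n c : ℕ} (hw : 0 < w) (I : ℕ → State → Prop)
    (hI : ∀ i s, I i s → s.reg j = i ∧ s.reg b = n)
    (hP : ∀ i < n, ∀ s, I i s → ∃ s' m, Exec w P s s' m ∧ m ≤ c ∧ I (i + 1) s')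
    {s : State} (hs : I 0 s) :
    ∃ s' m, Exec w (.loop (.bin .lt (.reg j) (.reg b)) P) s s' m ∧ m ≤ n * (c + 4) + 4 ∧
      I n s' := by
  have hone := Nat.one_lt_two_pow hw.ne'
  -- The induction is on the number `l` of remaining rounds; each test costs `4` steps, including
  -- the final one that fails.
  suffices H : ∀ l i, i + l = n → ∀ s, I i s →
      ∃ s' m, Exec w (.loop (.bin .lt (.reg j) (.reg b)) P) s s' m ∧ m ≤ l * (c + 4) + 4 ∧
        I n s' from H n 0 (by omega) s hs
  intro l
  induction l with
  | zero =>
    intro i hi s hs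
    obtain ⟨h₁, h₂⟩ := hI i s hs
    obtain rfl : i = n := by omega
    refine ⟨s, _, Exec.loop_done ?_, ?_, hs⟩
    · simp [Expr.eval, Op.apply, h₁, h₂]
    · simp [Expr.cost]
  | succ l ih =>
    intro i hi s hs
    obtain ⟨h₁, h₂⟩ := hI i s hs
    obtain ⟨s₁, m₁, e₁, hm₁, hs₁⟩ := hP i (by omega) s hs
    obtain ⟨s₂, m₂, e₂, hm₂, hs₂⟩ := ih (i + 1) (by omega) s₁ hs₁
    refine ⟨s₂, _, Exec.loop_step ?_ e₁ e₂, ?_, hs₂⟩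
    · have : i < n := by omega
      simp [Expr.eval, Op.apply, h₁, h₂, this, Nat.mod_eq_of_lt hone]
    · simp only [Expr.cost]
      rw [Nat.succ_mul]
      omega

/-- The loop invariant keeps the bound in register `d`, the partial result `acc j` in `d + 1` and
the counter `j`, which is the new variable of the body, in `d + 2`. The counter cannot wrap around
because `n ≤ R < 2 ^ w`; overflow of the partial results is left to `hacc`. A round costs `12` steps
besides the body: `4` for the test and `4` for each of the two assignments. -/
theorem Ev.fold {o : Op} {init : ℕ} {bound body : Tm} {n : ℕ} (hw : 0 < w) (hR : R < 2 ^ w)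
    (hinit : init < 2 ^ w) (hb : Ev w R mem env bound n) (hn : n ≤ R) (f acc : ℕ → ℕ)
    (hf : ∀ j < n, Ev w R mem (scons j env) body (f j)) (h0 : acc 0 = init)
    (hacc : ∀ j < n, o.apply w (acc j) (f j) = acc (j + 1)) :
    Ev w R mem env (.fold o init bound body) (acc n) := by
  intro ρ d s hρ hmem henv
  obtain ⟨s₁, m₁, h₁, hm₁, hmem₁, hr₁, hv₁⟩ := hb ρ d s hρ hmem henv
  have hpos : 0 < 2 ^ w := by positivity
  have hone := Nat.one_lt_two_pow hw.ne'
  let I : ℕ → State → Prop := fun j s' => (s'.reg (d + 2) = j ∧ s'.reg d = n) ∧ s'.mem = mem ∧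
    (∀ r < d, s'.reg r = s.reg r) ∧ s'.reg (d + 1) = acc j
  have key := exec_count (w := w) (j := d + 2) (b := d) (c := body.cost R + 8) (n := n)
    (P := .seq (body.compile (scons (d + 2) ρ) (d + 3))
            (.seq (.assign (d + 1) (.bin o (.reg (d + 1)) (.reg (d + 3))))
              (.assign (d + 2) (.bin .add (.reg (d + 2)) (.const 1))))) hw I (fun i s h => h.1) ?_
    (s := (s₁.set (d + 1) init).set (d + 2) 0) ?_
  · obtain ⟨s₂, m₂, h₂, hm₂, ⟨-, hn₂⟩, hmem₂, hr₂, hv₂⟩ := key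
    refine ⟨s₂.set d (acc n), _, h₁.seq ((Exec.assign' (v := init) ?_).seq
      ((Exec.assign' (v := 0) ?_).seq (h₂.seq (Exec.assign' ?_)))), ?_, by simpa,
      fun r hr => by rw [s₂.set_reg_ne _ hr.ne, hr₂ r hr], by simp⟩
    · simp [Expr.eval, Nat.mod_eq_of_lt hinit]
    · simp [Expr.eval]
    · simp [Expr.eval, hv₂]
    · have : n * (body.cost R + 8 + 4) ≤ R * (body.cost R + 12) := Nat.mul_le_mul hn le_rfl
      simp only [Expr.cost, Tm.cost]
      omega
  · rintro j hj t ⟨⟨hj₁, hn₁⟩, hmemt, hrt, hat⟩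
    obtain ⟨s₂, m₂, h₂, hm₂, hmem₂, hr₂, hv₂⟩ := hf j hj (scons (d + 2) ρ) (d + 3) t
      (by rintro (_ | i); · simp
          · have := hρ i; simp only [scons_succ]; omega)
      hmemt
      (by rintro (_ | i); · simpa
          · simp [hrt _ (hρ i), henv])
    refine ⟨(s₂.set (d + 1) (acc (j + 1))).set (d + 2) (j + 1), _,
      h₂.seq ((Exec.assign' ?_).seq (Exec.assign' ?_)), ?_, ⟨?_, ?_⟩, by simpa, ?_, ?_⟩
    · simp only [Expr.eval]
      rw [hr₂ _ (by omega), hat, hv₂, hacc j hj]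
    · simp only [Expr.eval, Op.apply]
      rw [State.set_reg_ne _ _ (by omega), hr₂ _ (by omega), hj₁, Nat.mod_eq_of_lt hone,
        Nat.mod_eq_of_lt (by omega)]
    · simp only [Expr.cost]; omega
    · simp
    · rw [State.set_reg_ne _ _ (by omega), State.set_reg_ne _ _ (by omega), hr₂ _ (by omega), hn₁]
    · intro r hr
      rw [State.set_reg_ne _ _ (by omega), State.set_reg_ne _ _ (by omega), hr₂ _ (by omega),
        hrt r hr]
    · rw [State.set_reg_ne _ _ (by omega)]; simp
  · refine ⟨⟨by simp, ?_⟩, by simpa, ?_, ?_⟩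
    · rw [State.set_reg_ne _ _ (by omega), State.set_reg_ne _ _ (by omega), hv₁]
    · intro r hr
      rw [State.set_reg_ne _ _ (by omega), State.set_reg_ne _ _ (by omega), hr₁ r hr]
    · rw [State.set_reg_ne _ _ (by omega)]; simp [h0]

theorem Ev.sum {bound body : Tm} {n : ℕ} (hw : 0 < w) (hR : R < 2 ^ w)
    (hb : Ev w R mem env bound n) (hn : n ≤ R) (f : ℕ → ℕ)
    (hf : ∀ j < n, Ev w R mem (scons j env) body (f j))
    (h : ∑ j ∈ Finset.range n, f j < 2 ^ w) :
    Ev w R mem env (.fold .add 0 bound body) (∑ j ∈ Finset.range n, f j) := by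
  refine Ev.fold hw hR (by positivity) hb hn f (fun m => ∑ j ∈ Finset.range m, f j) hf (by simp) ?_
  intro j hj
  simp only [Op.apply, Finset.sum_range_succ]
  refine Nat.mod_eq_of_lt (lt_of_le_of_lt ?_ h)
  rw [← Finset.sum_range_succ]
  exact Finset.sum_le_sum_of_subset (Finset.range_subset_range.2 hj)

/-- As all factors are at least `1`, partial products are bounded by the whole product, so only the
latter has to fit into a word. -/
theorem Ev.prod {bound body : Tm} {n : ℕ} (hw : 0 < w) (hR : R < 2 ^ w)
    (hb : Ev w R mem env bound n) (hn : n ≤ R) (f : ℕ → ℕ) (hpos : ∀ j, 1 ≤ f j)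
    (hf : ∀ j < n, Ev w R mem (scons j env) body (f j))
    (h : ∏ j ∈ Finset.range n, f j < 2 ^ w) :
    Ev w R mem env (.fold .mul 1 bound body) (∏ j ∈ Finset.range n, f j) := by
  refine Ev.fold hw hR (Nat.one_lt_two_pow hw.ne') hb hn f (fun m => ∏ j ∈ Finset.range m, f j) hf
    (by simp) ?_
  intro j hj
  simp only [Op.apply, Finset.prod_range_succ]
  refine Nat.mod_eq_of_lt (lt_of_le_of_lt ?_ h)
  rw [← Finset.prod_range_succ]
  exact Finset.prod_le_prod_of_subset_of_one_le' (Finset.range_subset_range.2 hj)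
    (fun i _ _ => hpos i)

theorem Ev.congr {e : Tm} {x y : ℕ} (h : Ev w R mem env e x) (hxy : x = y) :
    Ev w R mem env e y := hxy ▸ h

end Rules

end WordRAM

/-! ## Mixed encodings of partial functions as numbers -/

section Encoding

open Classical in
/-- The weight of position `v` if the members of `P` carry one digit in base `C` each. -/
noncomputable def digitWeight (P : ℕ → Prop) (C v : ℕ) : ℕ :=
  ∏ u ∈ Finset.range v, if P u then C else 1

open Classical in
/-- The number whose digits in base `C` are the values of `f` at the members of `P` below `n`. -/
noncomputable def encodeDigits (P : ℕ → Prop) (C n : ℕ) (f : ℕ → ℕ) : ℕ :=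
  ∑ v ∈ Finset.range n, if P v then f v * digitWeight P C v else 0

variable {P : ℕ → Prop} {C : ℕ}

theorem digitWeight_pos (hC : 0 < C) (v : ℕ) : 0 < digitWeight P C v := by
  refine Finset.prod_pos fun u _ => ?_
  split_ifs
  exacts [hC, one_pos]

theorem digitWeight_succ_of_mem {v : ℕ} (hv : P v) :
    digitWeight P C (v + 1) = digitWeight P C v * C := by
  simp [digitWeight, Finset.prod_range_succ, hv]

theorem digitWeight_succ_of_notMem {v : ℕ} (hv : ¬ P v) :
    digitWeight P C (v + 1) = digitWeight P C v := by
  simp [digitWeight, Finset.prod_range_succ, hv]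

theorem digitWeight_dvd {u v : ℕ} (h : u ≤ v) : digitWeight P C u ∣ digitWeight P C v :=
  Finset.prod_dvd_prod_of_subset _ _ _ (Finset.range_subset_range.2 h)

theorem encodeDigits_lt {f : ℕ → ℕ} {n : ℕ} (hf : ∀ v < n, P v → f v < C) :
    encodeDigits P C n f < digitWeight P C n := by
  induction n with
  | zero => simp [encodeDigits, digitWeight]
  | succ n ih =>
    have ih' := ih fun v hv => hf v (hv.trans n.lt_succ_self)
    by_cases hn : P n
    · rw [digitWeight_succ_of_mem hn]
      have h1 : encodeDigits P C (n + 1) f = encodeDigits P C n f + f n * digitWeight P C n := by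
        simp [encodeDigits, Finset.sum_range_succ, hn]
      have h2 : (f n + 1) * digitWeight P C n ≤ C * digitWeight P C n :=
        Nat.mul_le_mul_right _ (hf n n.lt_succ_self hn)
      rw [h1]
      nlinarith
    · rw [digitWeight_succ_of_notMem hn]
      simpa [encodeDigits, Finset.sum_range_succ, hn] using ih'

/-- Positions above `v` contribute multiples of `C` times the weight of `v`, and positions below `v`
add up to less than that weight. -/
theorem encodeDigits_div_mod (hC : 0 < C) {f : ℕ → ℕ} {n v : ℕ} (hf : ∀ v < n, P v → f v < C)
    (hv : v < n) (hP : P v) : encodeDigits P C n f / digitWeight P C v % C = f v := by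
  induction n with
  | zero => omega
  | succ n ih =>
    have hf' : ∀ v < n, P v → f v < C := fun v hv => hf v (hv.trans n.lt_succ_self)
    have hpos := digitWeight_pos (P := P) hC v
    rcases Nat.lt_succ_iff_lt_or_eq.1 hv with hvn | rfl
    · by_cases hn : P n
      · have h1 : encodeDigits P C (n + 1) f = encodeDigits P C n f + f n * digitWeight P C n := by
          simp [encodeDigits, Finset.sum_range_succ, hn]
        obtain ⟨q, hq⟩ := digitWeight_dvd (P := P) (C := C) (Nat.succ_le_of_lt hvn)
        rw [Nat.succ_eq_add_one, digitWeight_succ_of_mem hP] at hq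
        rw [h1, hq, show f n * (digitWeight P C v * C * q) = digitWeight P C v * (C * (f n * q)) by
          ring, Nat.add_mul_div_left _ _ hpos, Nat.add_mul_mod_self_left, ih hf' hvn]
      · simpa [encodeDigits, Finset.sum_range_succ, hn] using ih hf' hvn
    · have h1 : encodeDigits P C (v + 1) f = encodeDigits P C v f + digitWeight P C v * f v := by
        simp [encodeDigits, Finset.sum_range_succ, hP, mul_comm]
      rw [h1, Nat.add_mul_div_left _ _ hpos, Nat.div_eq_of_lt (encodeDigits_lt hf'), zero_add,
        Nat.mod_eq_of_lt (hf v hv hP)]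

theorem encodeDigits_congr {f g : ℕ → ℕ} {n : ℕ} (h : ∀ v < n, P v → f v = g v) :
    encodeDigits P C n f = encodeDigits P C n g := by
  refine Finset.sum_congr rfl fun v hv => ?_
  split_ifs with hP
  · rw [h v (Finset.mem_range.1 hv) hP]
  · rfl

theorem encodeDigits_eq_zero {f : ℕ → ℕ} {n : ℕ} (h : ∀ v < n, ¬ P v) :
    encodeDigits P C n f = 0 :=
  Finset.sum_eq_zero fun v hv => if_neg (h v (Finset.mem_range.1 hv))

open Classical in
theorem digitWeight_eq_pow (n : ℕ) :
    digitWeight P C n = C ^ ((Finset.range n).filter P).card := by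
  simp [digitWeight, Finset.prod_ite]

end Encoding

/-! ## Activity budgets -/

section Budget

open Classical in
/-- The budget of activity of a vertex before each time step: it is `M` at the beginning, an active
time step takes one unit, an inactive time step takes the rest of the current block of `L` units. -/
noncomputable def budget (L M : ℕ) (A : ℕ → Prop) : ℕ → ℕ
  | 0 => M
  | i + 1 => if A i then budget L M A i - 1 else budget L M A i / L * L

/-- The budget suffices for all activities before time `T`. -/
def Feasible (L M T : ℕ) (A : ℕ → Prop) : Prop := ∀ i < T, A i → budget L M A i ≠ 0

variable {L M T : ℕ} {A : ℕ → Prop}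

theorem budget_succ_of_active {i : ℕ} (h : A i) : budget L M A (i + 1) = budget L M A i - 1 :=
  if_pos h

theorem budget_succ_of_not_active {i : ℕ} (h : ¬ A i) :
    budget L M A (i + 1) = budget L M A i / L * L :=
  if_neg h

theorem budget_succ_le (i : ℕ) : budget L M A (i + 1) ≤ budget L M A i := by
  by_cases h : A i
  · rw [budget_succ_of_active h]; omega
  · rw [budget_succ_of_not_active h]; exact Nat.div_mul_le_self _ _

theorem budget_le (i : ℕ) : budget L M A i ≤ M := by
  induction i with
  | zero => exact le_rfl
  | succ i ih => exact (budget_succ_le i).trans ih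

/-- The budget recursion is monotone, so a sequence that decreases at least as fast stays below the
budget. This leaves slack: a path may declare a smaller budget than is actually available. -/
theorem feasible_of_lower_bound (μ : ℕ → ℕ) (h0 : μ 0 ≤ M)
    (hA : ∀ i < T, A i → μ (i + 1) + 1 ≤ μ i) (hnA : ∀ i < T, ¬ A i → μ (i + 1) ≤ μ i / L * L) :
    Feasible L M T A := by
  have key : ∀ i ≤ T, μ i ≤ budget L M A i := by
    intro i
    induction i with
    | zero => exact fun _ => h0
    | succ i ih =>
      intro hi
      have ih' := ih (by omega)
      by_cases h : A i
      · rw [budget_succ_of_active h]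
        have := hA i (by omega) h
        omega
      · rw [budget_succ_of_not_active h]
        exact (hnA i (by omega) h).trans (Nat.mul_le_mul_right _ (Nat.div_le_div_right ih'))
  intro i hi h
  have h1 := key i hi.le
  have h2 := hA i hi h
  omega

open Classical in
-- Each active time costs a full unit; feasibility excludes free activity at budget `0`, where the
-- subtraction is truncated.
theorem Feasible.sum_add_budget_le (h : Feasible L M T A) (a b : ℕ) (hab : a ≤ b) (hb : b ≤ T) :
    (∑ i ∈ Finset.Ico a b, if A i then 1 else 0) + budget L M A b ≤ budget L M A a := by
  induction b, hab using Nat.le_induction with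
  | base => simp
  | succ b hab ih =>
    rw [Finset.sum_Ico_succ_top hab]
    have ih' := ih (by omega)
    by_cases hA : A b
    · have := h b (by omega) hA
      rw [budget_succ_of_active hA, if_pos hA]
      omega
    · have := budget_succ_le (L := L) (M := M) (A := A) b
      rw [if_neg hA]
      omega

/-- The budget always contains a full block for every interval that has not started, plus the
remaining length of any single interval that has. At an active time the unit is paid either from the
block of a starting interval or from the rest of a running one. At an inactive time every started
interval is over, and rounding down keeps the reserved full blocks. -/
theorem feasible_of_intervals {ι : Type*} (I : Finset ι) (a b : ι → ℕ) {k ℓ : ℕ} (hk : I.card ≤ k)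
    (hI : ∀ x ∈ I, b x - a x ≤ ℓ) :
    Feasible (ℓ + 1) (k * (ℓ + 1)) T fun i => ∃ x ∈ I, a x ≤ i ∧ i ≤ b x := by
  classical
  set A : ℕ → Prop := fun i => ∃ x ∈ I, a x ≤ i ∧ i ≤ b x with hA
  set r : ℕ → ℕ := fun i => (I.filter fun x => i ≤ a x).card with hr
  have hr_anti : ∀ i, r (i + 1) ≤ r i := fun i =>
    Finset.card_le_card fun x hx => by
      simp only [Finset.mem_filter] at hx ⊢; exact ⟨hx.1, by omega⟩
  have hr_start : ∀ i, ∀ x ∈ I, a x = i → r (i + 1) + 1 ≤ r i := fun i x hx hi => by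
    refine Nat.succ_le_of_lt (Finset.card_lt_card (Finset.ssubset_iff_of_subset
      (fun y hy => ?_) |>.2 ⟨x, ?_, ?_⟩))
    · simp only [Finset.mem_filter] at hy ⊢; exact ⟨hy.1, by omega⟩
    · simp [hx, hi]
    · simp [hi]
  have key : ∀ i, (ℓ + 1) * r i ≤ budget (ℓ + 1) (k * (ℓ + 1)) A i ∧
      ∀ x ∈ I, a x < i → (ℓ + 1) * r i + (b x + 1 - i) ≤ budget (ℓ + 1) (k * (ℓ + 1)) A i := by
    intro i
    induction i with
    | zero =>
      refine ⟨?_, by omega⟩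
      rw [mul_comm]
      exact Nat.mul_le_mul_right _ ((Finset.card_filter_le _ _).trans hk)
    | succ i ih =>
      obtain ⟨ih1, ih2⟩ := ih
      have hm := Nat.mul_le_mul_left (ℓ + 1) (hr_anti i)
      by_cases hi : A i
      · rw [budget_succ_of_active hi]
        by_cases hs : ∃ x ∈ I, a x = i
        · obtain ⟨x, hx, hxi⟩ := hs
          have := Nat.mul_le_mul_left (ℓ + 1) (hr_start i x hx hxi)
          rw [mul_add] at this
          refine ⟨by omega, fun y hy hyi => ?_⟩
          have := hI y hy
          omega
        · obtain ⟨x, hx, hx1, hx2⟩ := hi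
          have hxi : a x < i := lt_of_le_of_ne hx1 fun h => hs ⟨x, hx, h⟩
          have := ih2 x hx hxi
          refine ⟨by omega, fun y hy hyi => ?_⟩
          have hyi : a y < i := lt_of_le_of_ne (by omega) fun h => hs ⟨y, hy, h⟩
          have := ih2 y hy hyi
          omega
      · rw [budget_succ_of_not_active hi]
        have h1 : (ℓ + 1) * r (i + 1) ≤
            budget (ℓ + 1) (k * (ℓ + 1)) A i / (ℓ + 1) * (ℓ + 1) := by
          rw [mul_comm _ (r (i + 1))]
          refine Nat.mul_le_mul_right _ ((Nat.le_div_iff_mul_le ℓ.succ_pos).2 ?_)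
          rw [mul_comm]
          exact hm.trans ih1
        refine ⟨h1, fun x hx hxi => ?_⟩
        have : ¬ i ≤ b x := fun h => hi ⟨x, hx, by omega, h⟩
        have : b x + 1 - (i + 1) = 0 := by omega
        rw [this]
        exact h1
  rintro i - ⟨x, hx, hx1, hx2⟩
  obtain ⟨h1, h2⟩ := key i
  rcases hx1.lt_or_eq with h | h
  · have := h2 x hx h
    omega
  · have := Nat.mul_le_mul_left (ℓ + 1) (hr_start i x hx h)
    rw [mul_add] at this
    omega

/-- Greedy covering: an interval is started when an active time meets a budget that is a whole
number of blocks. The invariant says that the starts and the full blocks left number at most `k`,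
and that a nonzero remainder of the budget is the remaining length of some chosen interval. -/
theorem Feasible.exists_starts {k ℓ : ℕ} (h : Feasible (ℓ + 1) (k * (ℓ + 1)) T A) :
    ∃ S : Finset ℕ, (∀ s ∈ S, s < T) ∧ S.card ≤ k ∧ ∀ i < T, A i → ∃ s ∈ S, s ≤ i ∧ i ≤ s + ℓ := by
  suffices H : ∀ i ≤ T, ∃ S : Finset ℕ, (∀ s ∈ S, s < i) ∧
      S.card + budget (ℓ + 1) (k * (ℓ + 1)) A i / (ℓ + 1) ≤ k ∧
      (∀ j < i, A j → ∃ s ∈ S, s ≤ j ∧ j ≤ s + ℓ) ∧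
      (budget (ℓ + 1) (k * (ℓ + 1)) A i % (ℓ + 1) ≠ 0 →
        ∃ s ∈ S, s + (ℓ + 1) = i + budget (ℓ + 1) (k * (ℓ + 1)) A i % (ℓ + 1)) by
    obtain ⟨S, h1, h2, h3, -⟩ := H T le_rfl
    exact ⟨S, h1, (Nat.le_add_right _ _).trans h2, h3⟩
  intro i
  induction i with
  | zero => exact fun _ => ⟨∅, by simp, by simp [budget], by simp, by simp [budget]⟩
  | succ i ih =>
    intro hi
    obtain ⟨S, h1, h2, h3, h4⟩ := ih (by omega)
    set μ := budget (ℓ + 1) (k * (ℓ + 1)) A i with hμ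
    by_cases hA : A i
    · have hμ0 : μ ≠ 0 := h i (by omega) hA
      rw [budget_succ_of_active hA, ← hμ]
      have hdm := Nat.div_add_mod μ (ℓ + 1)
      have hlt : μ % (ℓ + 1) < ℓ + 1 := Nat.mod_lt μ (Nat.succ_pos ℓ)
      -- With remainder `0` the active time breaks a new block, so `i` becomes a start and `ℓ` units
      -- of the block remain; otherwise the open interval covers `i`.
      by_cases hr : μ % (ℓ + 1) = 0
      · obtain ⟨q, hq⟩ : ∃ q, μ / (ℓ + 1) = q + 1 := by
          refine Nat.exists_eq_succ_of_ne_zero fun h0 => hμ0 ?_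
          rw [← hdm, h0, hr]; simp
        have hμ1 : μ - 1 = ℓ + (ℓ + 1) * q := by
          rw [hr, hq, mul_add] at hdm; omega
        have hd : (μ - 1) / (ℓ + 1) = q := by
          rw [hμ1, Nat.add_mul_div_left _ _ ℓ.succ_pos, Nat.div_eq_of_lt ℓ.lt_succ_self, zero_add]
        have hm : (μ - 1) % (ℓ + 1) = ℓ := by
          rw [hμ1, Nat.add_mul_mod_self_left, Nat.mod_eq_of_lt ℓ.lt_succ_self]
        refine ⟨insert i S, ?_, ?_, ?_, ?_⟩
        · simp only [Finset.mem_insert, forall_eq_or_imp]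
          exact ⟨i.lt_succ_self, fun s hs => (h1 s hs).trans i.lt_succ_self⟩
        · have := Finset.card_insert_le i S
          rw [hd]
          omega
        · intro j hj hAj
          rcases Nat.lt_succ_iff_lt_or_eq.1 hj with hj | rfl
          · obtain ⟨s, hs, hs'⟩ := h3 j hj hAj
            exact ⟨s, Finset.mem_insert_of_mem hs, hs'⟩
          · exact ⟨j, Finset.mem_insert_self _ _, le_rfl, by omega⟩
        · intro _
          exact ⟨i, Finset.mem_insert_self _ _, by rw [hm]; omega⟩
      · obtain ⟨s, hs, hsi⟩ := h4 hr
        have hμ1 : μ - 1 = (μ % (ℓ + 1) - 1) + (ℓ + 1) * (μ / (ℓ + 1)) := by omega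
        have hd : (μ - 1) / (ℓ + 1) = μ / (ℓ + 1) := by
          rw [hμ1, Nat.add_mul_div_left _ _ ℓ.succ_pos, Nat.div_eq_of_lt (by omega), zero_add]
        have hm : (μ - 1) % (ℓ + 1) = μ % (ℓ + 1) - 1 := by
          rw [hμ1, Nat.add_mul_mod_self_left, Nat.mod_eq_of_lt (by omega)]
        refine ⟨S, fun s hs => (h1 s hs).trans i.lt_succ_self, by rwa [hd], ?_, ?_⟩
        · intro j hj hAj
          rcases Nat.lt_succ_iff_lt_or_eq.1 hj with hj | rfl
          · exact h3 j hj hAj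
          · exact ⟨s, hs, (h1 s hs).le, by omega⟩
        · intro _
          exact ⟨s, hs, by rw [hm]; omega⟩
    -- Rounding down abandons the open interval: the number of full blocks is unchanged and the
    -- remainder becomes `0`.
    · rw [budget_succ_of_not_active hA, ← hμ]
      refine ⟨S, fun s hs => (h1 s hs).trans i.lt_succ_self, ?_, ?_, ?_⟩
      · rwa [Nat.mul_div_cancel _ ℓ.succ_pos]
      · intro j hj hAj
        rcases Nat.lt_succ_iff_lt_or_eq.1 hj with hj | rfl
        · exact h3 j hj hAj
        · exact absurd hAj hA
      · simp

end Budget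

/-! ## The dynamic program -/

/-- An instance of the problem whose vertices and time steps are natural numbers. -/
structure TimelineInstance where
  n : ℕ
  T : ℕ
  k : ℕ
  ℓ : ℕ
  adj : ℕ → ℕ → ℕ → Prop
  symm : ∀ {p u v}, adj p u v → adj p v u
  lt : ∀ {p u v}, adj p u v → p < T ∧ u < n ∧ v < n

namespace TimelineInstance

variable (D : TimelineInstance)

/-- The initial budget of a vertex. -/
def M : ℕ := D.k * (D.ℓ + 1)

/-- The number of pairs of a budget and a decision whether to be active. -/
def C : ℕ := 2 * (D.M + 1)

/-- The vertex `v` is not isolated in snapshot `p`. -/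
def NonIsolated (p v : ℕ) : Prop := ∃ u < D.n, D.adj p u v

/-- The vertex `v` is not isolated at some time before `a` and at some time from `b` on. -/
def Spans (a b v : ℕ) : Prop := (∃ p < a, D.NonIsolated p v) ∧ ∃ q < D.T, b ≤ q ∧ D.NonIsolated q v

/-- The vertices whose budgets are carried over to time `i` from the time before. -/
abbrev Carried (i v : ℕ) : Prop := D.Spans i i v

/-- The bag at time `i`. -/
abbrev InBag (i v : ℕ) : Prop := D.Spans (i + 1) i v

/-- The number of configurations at time `i`. A configuration consists of a budget and a decision
for each vertex in the bag. -/
noncomputable def numConfigs (i : ℕ) : ℕ := digitWeight (D.InBag i) D.C D.n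

/-- The digit of `v` in a configuration. -/
noncomputable def digit (i z v : ℕ) : ℕ := z / digitWeight (D.InBag i) D.C v % D.C

/-- The budget of `v` in a configuration. -/
noncomputable def before (i z v : ℕ) : ℕ := D.digit i z v / 2

/-- The vertex `v` is active in a configuration. -/
def Act (i z v : ℕ) : Prop := (D.InBag i v ∧ D.before i z v ≠ 0) ∧ D.digit i z v % 2 = 1

open Classical in
/-- The budget of `v` after time `i`. -/
noncomputable def after (i z v : ℕ) : ℕ :=
  if D.Act i z v then D.before i z v - 1 else D.before i z v / (D.ℓ + 1) * (D.ℓ + 1)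

/-- The code of the budgets carried over to time `i`. -/
noncomputable def source (i z : ℕ) : ℕ := encodeDigits (D.Carried i) D.C D.n (D.before i z)

/-- The code of the budgets carried over from time `i` to the next time. -/
noncomputable def target (i z : ℕ) : ℕ := encodeDigits (D.Carried (i + 1)) D.C D.n (D.after i z)

/-- The vertex `v` is dominated in a configuration. -/
def Dom (i z v : ℕ) : Prop := ∃ u < D.n, D.Act i z u ∧ (u = v ∨ D.adj i u v)

open Classical in
/-- The number of temporal vertices `(v, j)` for which a configuration at time `i` accounts: `j = i`
if `v` is in the bag, also those with `j < i` if `v` is in no earlier bag, and those with `j > i` if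
`v` is in no later bag. -/
noncomputable def vertexGain (i z v : ℕ) : ℕ :=
  if D.InBag i v then
    (if D.Dom i z v then 1 else 0) + ((if D.Carried i v then 0 else min i (D.M - D.before i z v)) +
      (if D.Carried (i + 1) v then 0 else min (D.T - 1 - i) (D.after i z v)))
  else 0

/-- The number of temporal vertices for which a configuration accounts. -/
noncomputable def gain (i z : ℕ) : ℕ := ∑ v ∈ Finset.range D.n, D.vertexGain i z v

open Classical in
/-- The number of temporal vertices dominated by a vertex that is isolated all the time. -/
noncomputable def isolatedGain (v : ℕ) : ℕ := if D.Spans D.T 0 v then 0 else min D.T D.M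

/-- The number of temporal vertices dominated by the vertices that are isolated all the time. -/
noncomputable def totalIsolatedGain : ℕ := ∑ v ∈ Finset.range D.n, D.isolatedGain v

/-- The table of the dynamic program: one plus the maximal number of temporal vertices for which
configurations at the times before `i` account that lead to the code `y`, and `0` if there are no
such configurations. -/
noncomputable def table : ℕ → ℕ → ℕ
  | 0, y => if y = 0 then 1 + D.totalIsolatedGain else 0
  | i + 1, y => (Finset.range (D.numConfigs i)).sup fun z =>
      if D.target i z = y then
        if table i (D.source i z) = 0 then 0 else table i (D.source i z) + D.gain i z
      else 0

/-- Configurations for the times before `i` that fit together. -/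
def IsPath (i : ℕ) (ζ : ℕ → ℕ) : Prop :=
  (∀ j < i, ζ j < D.numConfigs j) ∧ ∀ j, j + 1 < i → D.source (j + 1) (ζ (j + 1)) = D.target j (ζ j)

theorem not_carried_zero (v : ℕ) : ¬ D.Carried 0 v := fun h => by
  obtain ⟨⟨p, hp, -⟩, -⟩ := h; omega

theorem not_carried_T (v : ℕ) : ¬ D.Carried D.T v := fun h => by
  obtain ⟨-, q, hq, hq', -⟩ := h; omega

theorem source_zero (z : ℕ) : D.source 0 z = 0 :=
  encodeDigits_eq_zero fun v _ => D.not_carried_zero v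

theorem target_last (z i : ℕ) (hi : i + 1 = D.T) : D.target i z = 0 :=
  encodeDigits_eq_zero fun v _ => by rw [hi]; exact D.not_carried_T v

/-- A positive entry is attained by some configuration; tracing the maximizers back to time `0`
yields the path. -/
theorem exists_path_of_table {i y a : ℕ} (h : D.table i y = a + 1) :
    ∃ ζ, D.IsPath i ζ ∧ (i = 0 → y = 0) ∧ (∀ j, i = j + 1 → D.target j (ζ j) = y) ∧
      D.totalIsolatedGain + ∑ j ∈ Finset.range i, D.gain j (ζ j) = a := by
  induction i generalizing y a with
  | zero =>
    have hy : y = 0 := by by_contra hy; simp [table, hy] at h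
    refine ⟨fun _ => 0, ⟨by simp, by simp⟩, fun _ => hy, by simp, ?_⟩
    simp [table, hy] at h ⊢
    omega
  | succ i ih =>
    have hne : (Finset.range (D.numConfigs i)).Nonempty := by
      by_contra hemp
      rw [Finset.not_nonempty_iff_eq_empty] at hemp
      simp [table, hemp] at h
    obtain ⟨z, hz, hz'⟩ := Finset.exists_mem_eq_sup _ hne fun z =>
      if D.target i z = y then
        if D.table i (D.source i z) = 0 then 0 else D.table i (D.source i z) + D.gain i z
      else 0
    rw [table, hz'] at h
    by_cases hy : D.target i z = y
    · by_cases h0 : D.table i (D.source i z) = 0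
      · simp [hy, h0] at h
      obtain ⟨b, hb⟩ := Nat.exists_eq_succ_of_ne_zero h0
      rw [if_pos hy, if_neg h0, hb] at h
      obtain ⟨ζ, ⟨hζ1, hζ2⟩, hζ0, hζe, hζs⟩ := ih hb
      have hlt : ∀ j < i, Function.update ζ i z j = ζ j := fun j hj =>
        Function.update_of_ne hj.ne _ _
      refine ⟨Function.update ζ i z, ⟨?_, ?_⟩, by simp, ?_, ?_⟩
      · intro j hj
        rcases Nat.lt_succ_iff_lt_or_eq.1 hj with hj | rfl
        · rw [hlt j hj]; exact hζ1 j hj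
        · simpa using Finset.mem_range.1 hz
      · intro j hj
        rw [hlt j (by omega)]
        rcases Nat.lt_succ_iff_lt_or_eq.1 hj with hj | rfl
        · rw [hlt _ hj]; exact hζ2 j hj
        · rw [Function.update_self]; exact (hζe j rfl).symm
      · intro j hj
        obtain rfl : i = j := by omega
        rw [Function.update_self, hy]
      · rw [Finset.sum_range_succ, Function.update_self,
          Finset.sum_congr rfl fun j hj => by rw [hlt j (Finset.mem_range.1 hj)]]
        omega
    · simp [hy] at h

theorem le_table_of_path {ζ : ℕ → ℕ} (i : ℕ) (h : D.IsPath i ζ) (y : ℕ) (h0 : i = 0 → y = 0)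
    (hy : ∀ j, i = j + 1 → D.target j (ζ j) = y) :
    1 + D.totalIsolatedGain + ∑ j ∈ Finset.range i, D.gain j (ζ j) ≤ D.table i y := by
  induction i generalizing y with
  | zero => simp [table, h0 rfl]
  | succ i ih =>
    have ih' := ih ⟨fun j hj => h.1 j (by omega), fun j hj => h.2 j (by omega)⟩
      (D.source i (ζ i)) (by rintro rfl; exact D.source_zero _)
      (by rintro j rfl; exact (h.2 j (by omega)).symm)
    rw [table]
    refine le_trans ?_ (Finset.le_sup (Finset.mem_range.2 (h.1 i i.lt_succ_self)))
    rw [if_pos (hy i rfl), if_neg (by omega), Finset.sum_range_succ]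
    omega

/-- The inequality is strict because entries are shifted by one to reserve `0` for unreachable
codes. Nothing is carried beyond the last time, so every path ends in code `0`. -/
theorem lt_table_iff (hT : 1 ≤ D.T) (t : ℕ) :
    t < D.table D.T 0 ↔ ∃ ζ, D.IsPath D.T ζ ∧
      t ≤ D.totalIsolatedGain + ∑ j ∈ Finset.range D.T, D.gain j (ζ j) := by
  constructor
  · intro h
    obtain ⟨a, ha⟩ := Nat.exists_eq_succ_of_ne_zero (show D.table D.T 0 ≠ 0 by omega)
    obtain ⟨ζ, hζ, -, -, hs⟩ := D.exists_path_of_table ha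
    exact ⟨ζ, hζ, by omega⟩
  · rintro ⟨ζ, hζ, h⟩
    have := D.le_table_of_path D.T hζ 0 (by omega) fun j hj => D.target_last _ _ hj.symm
    omega

/-! ### Paths and activities -/

theorem C_pos : 0 < D.C := by simp [C]

theorem before_le (i z v : ℕ) : D.before i z v ≤ D.M := by
  have h : D.digit i z v < D.C := Nat.mod_lt _ D.C_pos
  simp only [before, C] at *
  omega

theorem after_le_before (i z v : ℕ) : D.after i z v ≤ D.before i z v := by
  unfold after
  split_ifs
  · omega
  · exact Nat.div_mul_le_self _ _

theorem M_lt_C : D.M < D.C := by simp only [C]; omega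

/-- Equal codes have equal digits, since all budgets are at most `M < C`. -/
theorem IsPath.before_succ {ζ : ℕ → ℕ} (h : D.IsPath D.T ζ) {i v : ℕ} (hi : i + 1 < D.T)
    (hv : v < D.n) (hc : D.Carried (i + 1) v) :
    D.before (i + 1) (ζ (i + 1)) v = D.after i (ζ i) v := by
  have h1 : ∀ u < D.n, D.Carried (i + 1) u → D.before (i + 1) (ζ (i + 1)) u < D.C := fun u _ _ =>
    (D.before_le _ _ _).trans_lt D.M_lt_C
  have h2 : ∀ u < D.n, D.Carried (i + 1) u → D.after i (ζ i) u < D.C := fun u _ _ =>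
    ((D.after_le_before _ _ _).trans (D.before_le _ _ _)).trans_lt D.M_lt_C
  have e1 := encodeDigits_div_mod D.C_pos h1 hv hc
  have e2 := encodeDigits_div_mod D.C_pos h2 hv hc
  have := h.2 i hi
  rw [source, target] at this
  rw [← e1, this, e2]

theorem NonIsolated.lt {p v : ℕ} (h : D.NonIsolated p v) : p < D.T := by
  obtain ⟨u, -, h⟩ := h; exact (D.lt h).1

/-- The lifetime of a vertex that is not isolated all the time is an interval. -/
theorem exists_lifetime {v : ℕ} (h : D.Spans D.T 0 v) :
    ∃ s e, s ≤ e ∧ e < D.T ∧ ∀ a b, D.Spans a b v ↔ s < a ∧ b ≤ e := by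
  classical
  have hex : ∃ p, D.NonIsolated p v := by obtain ⟨⟨p, -, h⟩, -⟩ := h; exact ⟨p, h⟩
  have hspec := Nat.find_spec hex
  set S := (Finset.range D.T).filter fun q => D.NonIsolated q v with hS
  have hmem : ∀ q, q ∈ S ↔ D.NonIsolated q v := fun q => by
    simp only [hS, Finset.mem_filter, Finset.mem_range, and_iff_right_iff_imp]
    exact fun h => h.lt
  have hne : S.Nonempty := ⟨_, (hmem _).2 hspec⟩
  have hmax := (hmem _).1 (S.max'_mem hne)
  refine ⟨Nat.find hex, S.max' hne, Nat.find_min' hex hmax, hmax.lt, fun a b => ⟨?_, ?_⟩⟩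
  · rintro ⟨⟨p, hp, hp'⟩, q, -, hq, hq'⟩
    exact ⟨(Nat.find_min' hex hp').trans_lt hp, hq.trans (S.le_max' _ ((hmem _).2 hq'))⟩
  · rintro ⟨h1, h2⟩
    exact ⟨⟨_, h1, hspec⟩, _, hmax.lt, h2, hmax⟩

theorem nonIsolated_of_adj_left {p u v : ℕ} (h : D.adj p u v) : D.NonIsolated p u :=
  ⟨v, (D.lt h).2.2, D.symm h⟩

theorem nonIsolated_of_adj_right {p u v : ℕ} (h : D.adj p u v) : D.NonIsolated p v :=
  ⟨u, (D.lt h).2.1, h⟩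

theorem NonIsolated.inBag {p v : ℕ} (h : D.NonIsolated p v) : D.InBag p v :=
  ⟨⟨p, p.lt_succ_self, h⟩, p, h.lt, le_rfl, h⟩

theorem InBag.spans {i v : ℕ} (h : D.InBag i v) : D.Spans D.T 0 v := by
  obtain ⟨⟨p, -, hp⟩, q, hq, -, hq'⟩ := h
  exact ⟨⟨p, hp.lt, hp⟩, q, hq, Nat.zero_le _, hq'⟩

/-- The temporal vertex `(v, i)` is dominated if the vertices are active according to `A`. -/
def DomBy (A : ℕ → ℕ → Prop) (v i : ℕ) : Prop := ∃ u < D.n, A u i ∧ (u = v ∨ D.adj i u v)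

open Classical in
/-- The number of temporal vertices at `v` dominated by `A`. -/
noncomputable def vertexScore (A : ℕ → ℕ → Prop) (v : ℕ) : ℕ :=
  ∑ i ∈ Finset.range D.T, if D.DomBy A v i then 1 else 0

open Classical in
-- Within the bag interval, the vertex is not carried in only at time `s` and not carried out only
-- at time `e`. So each of the two contributions from outside the bag is counted exactly once.
theorem sum_vertexGain_of_lifetime {v s e : ℕ} (hse : s ≤ e) (he : e < D.T)
    (h : ∀ a b, D.Spans a b v ↔ s < a ∧ b ≤ e) (ζ : ℕ → ℕ) :
    ∑ i ∈ Finset.range D.T, D.vertexGain i (ζ i) v =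
      (∑ i ∈ Finset.range D.T, if D.InBag i v ∧ D.Dom i (ζ i) v then 1 else 0) +
        (min s (D.M - D.before s (ζ s) v) + min (D.T - 1 - e) (D.after e (ζ e) v)) := by
  have key : ∀ i ∈ Finset.range D.T, D.vertexGain i (ζ i) v =
      (if D.InBag i v ∧ D.Dom i (ζ i) v then 1 else 0) +
        ((if s = i then min i (D.M - D.before i (ζ i) v) else 0) +
          (if e = i then min (D.T - 1 - i) (D.after i (ζ i) v) else 0)) := by
    intro i _
    unfold vertexGain
    by_cases hi : D.InBag i v
    · have hi' := (h _ _).1 hi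
      have h1 : D.Carried i v ↔ ¬ s = i := by rw [Carried, h]; omega
      have h2 : D.Carried (i + 1) v ↔ ¬ e = i := by rw [Carried, h]; omega
      simp [hi, h1, h2]
    · have hi' : ¬ (s < i + 1 ∧ i ≤ e) := fun h' => hi ((h _ _).2 h')
      have h1 : ¬ s = i := by omega
      have h2 : ¬ e = i := by omega
      simp [hi, h1, h2]
  rw [Finset.sum_congr rfl key, Finset.sum_add_distrib, Finset.sum_add_distrib,
    Finset.sum_ite_eq, Finset.sum_ite_eq, if_pos (by simp; omega), if_pos (by simpa)]

theorem vertexGain_of_not_spans {v : ℕ} (h : ¬ D.Spans D.T 0 v) (i z : ℕ) :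
    D.vertexGain i z v = 0 :=
  if_neg fun h' => h h'.spans

open Classical in
/-- The configurations of a feasible activity. -/
noncomputable def configOf (A : ℕ → ℕ → Prop) (i : ℕ) : ℕ :=
  encodeDigits (D.InBag i) D.C D.n fun v =>
    2 * budget (D.ℓ + 1) D.M (A v) i + if A v i then 1 else 0

/-! ### From feasible activities to paths. -/

section ConfigOf

variable {A : ℕ → ℕ → Prop}

open Classical in
theorem configOf_digit_lt (i v : ℕ) :
    2 * budget (D.ℓ + 1) D.M (A v) i + (if A v i then 1 else 0) < D.C := by
  have := budget_le (L := D.ℓ + 1) (M := D.M) (A := A v) i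
  simp only [C]
  split_ifs <;> omega

open Classical in
theorem digit_configOf {i v : ℕ} (hv : v < D.n) (h : D.InBag i v) :
    D.digit i (D.configOf A i) v =
      2 * budget (D.ℓ + 1) D.M (A v) i + if A v i then 1 else 0 :=
  encodeDigits_div_mod D.C_pos (fun u _ _ => D.configOf_digit_lt i u) hv h

theorem before_configOf {i v : ℕ} (hv : v < D.n) (h : D.InBag i v) :
    D.before i (D.configOf A i) v = budget (D.ℓ + 1) D.M (A v) i := by
  rw [before, D.digit_configOf hv h]
  split_ifs <;> omega

variable (hA : ∀ v < D.n, Feasible (D.ℓ + 1) D.M D.T (A v))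
include hA

/-- An activity bit at budget `0` is read as inactive, so that every number in the range is a
legitimate configuration. Feasibility rules this case out here. -/
theorem act_configOf {i v : ℕ} (hi : i < D.T) (hv : v < D.n) (h : D.InBag i v) :
    D.Act i (D.configOf A i) v ↔ A v i := by
  rw [Act, D.before_configOf hv h, D.digit_configOf hv h]
  by_cases hAi : A v i
  · have := hA v hv i hi hAi
    simp [hAi, h, this]
  · simp [hAi]

theorem after_configOf {i v : ℕ} (hi : i < D.T) (hv : v < D.n) (h : D.InBag i v) :
    D.after i (D.configOf A i) v = budget (D.ℓ + 1) D.M (A v) (i + 1) := by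
  by_cases hAi : A v i
  · rw [after, if_pos ((D.act_configOf hA hi hv h).2 hAi), budget_succ_of_active hAi,
      D.before_configOf hv h]
  · rw [after, if_neg (mt (D.act_configOf hA hi hv h).1 hAi), budget_succ_of_not_active hAi,
      D.before_configOf hv h]

theorem isPath_configOf : D.IsPath D.T (D.configOf A) := by
  refine ⟨fun i _ => encodeDigits_lt fun u _ _ => D.configOf_digit_lt i u,
    fun i hi => encodeDigits_congr fun v hv hc => ?_⟩
  -- A carried vertex lies in both adjacent bags, so both codes store its budget at time `i + 1`.
  have h1 : D.InBag (i + 1) v := ⟨⟨_, hc.1.choose_spec.1.trans (Nat.lt_succ_self _),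
    hc.1.choose_spec.2⟩, hc.2⟩
  have h2 : D.InBag i v := by
    obtain ⟨hc1, q, hq, hq', hc2⟩ := hc
    exact ⟨hc1, q, hq, by omega, hc2⟩
  rw [D.before_configOf hv h1, D.after_configOf hA (by omega) hv h2]

open Classical in
-- Any vertex dominating a bag vertex `v` at time `i` is `v` itself or a neighbor, hence in the bag,
-- so the configuration sees it. Outside the bag `v` must be active itself, and its activity there
-- is limited by the number of times and by the budget spent.
theorem vertexScore_le {v : ℕ} (hv : v < D.n) :
    D.vertexScore A v ≤ D.isolatedGain v +
      ∑ i ∈ Finset.range D.T, D.vertexGain i (D.configOf A i) v := by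
  by_cases hs : D.Spans D.T 0 v
  · obtain ⟨s, e, hse, he, h⟩ := D.exists_lifetime hs
    have hs1 : D.InBag s v := (h _ _).2 (by omega)
    have he1 : D.InBag e v := (h _ _).2 (by omega)
    rw [D.sum_vertexGain_of_lifetime hse he h, isolatedGain, if_pos hs, zero_add,
      D.before_configOf hv hs1, D.after_configOf hA he hv he1]
    -- Activity before `s` costs at most the budget missing at time `s`; activity after `e` at most
    -- the budget left at time `e + 1`.
    have h1 := (hA v hv).sum_add_budget_le 0 s (Nat.zero_le _) (by omega)
    have h2 := (hA v hv).sum_add_budget_le (e + 1) D.T (by omega) le_rfl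
    have h3 : ∀ a b, (∑ i ∈ Finset.Ico a b, if A v i then 1 else 0) ≤ b - a := fun a b => by
      refine (Finset.sum_le_sum (g := fun _ => 1) fun i _ => by split_ifs <;> omega).trans ?_
      simp
    have h4 := h3 0 s
    have h5 := h3 (e + 1) D.T
    have h6 : D.vertexScore A v ≤
        ∑ i ∈ Finset.range D.T, ((if D.InBag i v ∧ D.Dom i (D.configOf A i) v then 1 else 0) +
          ((if i < s ∧ A v i then 1 else 0) + if e < i ∧ A v i then 1 else 0)) := by
      refine Finset.sum_le_sum fun i hi => ?_
      rw [Finset.mem_range] at hi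
      by_cases hd : D.DomBy A v i
      · rw [if_pos hd]
        by_cases hb : D.InBag i v
        · have : D.Dom i (D.configOf A i) v := by
            obtain ⟨u, hu, hAu, huv⟩ := hd
            refine ⟨u, hu, (D.act_configOf hA hi hu ?_).2 hAu, huv⟩
            rcases huv with rfl | huv
            · exact hb
            · exact (D.nonIsolated_of_adj_left huv).inBag
          simp [hb, this]
        · have hAv : A v i := by
            obtain ⟨u, hu, hAu, rfl | huv⟩ := hd
            · exact hAu
            · exact absurd (D.nonIsolated_of_adj_right huv).inBag hb
          have hi' : ¬ (s < i + 1 ∧ i ≤ e) := fun h' => hb ((h _ _).2 h')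
          rcases lt_or_ge i s with his | his
          · rw [if_pos (c := i < s ∧ _) ⟨his, hAv⟩]; omega
          · rw [if_pos (c := e < i ∧ _) ⟨by omega, hAv⟩]; omega
      · rw [if_neg hd]; exact Nat.zero_le _
    have h7 : (∑ i ∈ Finset.range D.T, if i < s ∧ A v i then 1 else 0) =
        ∑ i ∈ Finset.Ico 0 s, if A v i then 1 else 0 := by
      rw [← Finset.sum_filter, ← Finset.sum_filter]
      congr 1
      ext i
      simp only [Finset.mem_filter, Finset.mem_range, Finset.mem_Ico]
      constructor
      · rintro ⟨h0, h1, h2⟩; exact ⟨by omega, h2⟩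
      · rintro ⟨h1, h2⟩; exact ⟨by omega, by omega, h2⟩
    have h8 : (∑ i ∈ Finset.range D.T, if e < i ∧ A v i then 1 else 0) =
        ∑ i ∈ Finset.Ico (e + 1) D.T, if A v i then 1 else 0 := by
      rw [← Finset.sum_filter, ← Finset.sum_filter]
      congr 1
      ext i
      simp only [Finset.mem_filter, Finset.mem_range, Finset.mem_Ico]
      constructor
      · rintro ⟨h0, h1, h2⟩; exact ⟨by omega, h2⟩
      · rintro ⟨h1, h2⟩; exact ⟨by omega, by omega, h2⟩
    rw [Finset.sum_add_distrib, Finset.sum_add_distrib, h7, h8] at h6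
    have hM : budget (D.ℓ + 1) D.M (A v) 0 = D.M := rfl
    refine h6.trans (Nat.add_le_add_left (Nat.add_le_add (le_min ?_ ?_) (le_min ?_ ?_)) _) <;> omega
  · rw [isolatedGain, if_neg hs]
    refine le_add_right ?_
    have h1 := (hA v hv).sum_add_budget_le 0 D.T (Nat.zero_le _) le_rfl
    have h2 : D.vertexScore A v ≤ ∑ i ∈ Finset.Ico 0 D.T, if A v i then 1 else 0 := by
      rw [vertexScore, ← Finset.range_eq_Ico]
      refine Finset.sum_le_sum fun i hi => ?_
      by_cases hd : D.DomBy A v i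
      · obtain ⟨u, hu, hAu, rfl | huv⟩ := hd
        · rw [if_pos hAu]; split_ifs <;> omega
        · exact absurd (D.nonIsolated_of_adj_right huv).inBag.spans hs
      · rw [if_neg hd]; exact Nat.zero_le _
    refine le_min ?_ (h2.trans ((Nat.le_add_right _ _).trans (h1.trans le_rfl)))
    refine (Finset.sum_le_sum (g := fun _ => 1) fun i _ => by split_ifs <;> omega).trans ?_
    simp

end ConfigOf

/-! ### From paths to feasible activities. -/

open Classical in
/-- Each vertex can be active as often as the configurations of a path account for. -/
theorem IsPath.exists_activity {ζ : ℕ → ℕ} (hζ : D.IsPath D.T ζ) {v : ℕ} (hv : v < D.n) :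
    ∃ A : ℕ → Prop, Feasible (D.ℓ + 1) D.M D.T A ∧
      (∀ i < D.T, D.Act i (ζ i) v → A i) ∧
      D.isolatedGain v + ∑ i ∈ Finset.range D.T, D.vertexGain i (ζ i) v ≤
        (∑ i ∈ Finset.range D.T, if D.InBag i v ∧ D.Dom i (ζ i) v then 1 else 0) +
          ∑ i ∈ Finset.range D.T, if ¬ D.InBag i v ∧ A i then 1 else 0 := by
  -- The initial budget consists of whole blocks, so inactivity before the first active time costs
  -- nothing.
  have hMd : D.M / (D.ℓ + 1) * (D.ℓ + 1) = D.M := by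
    rw [M, Nat.mul_div_cancel _ (Nat.succ_pos _)]
  by_cases hs : D.Spans D.T 0 v
  · obtain ⟨s, e, hse, he, h⟩ := D.exists_lifetime hs
    rw [D.sum_vertexGain_of_lifetime hse he h, isolatedGain, if_pos hs, zero_add]
    set pre := min s (D.M - D.before s (ζ s) v) with hpre
    set post := min (D.T - 1 - e) (D.after e (ζ e) v) with hpost
    have hp1 : pre ≤ s := min_le_left _ _
    have hp2 : pre ≤ D.M - D.before s (ζ s) v := min_le_right _ _
    have hq1 : post ≤ D.T - 1 - e := min_le_left _ _
    have hq2 : post ≤ D.after e (ζ e) v := min_le_right _ _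
    have hb := D.before_le s (ζ s) v
    -- Activity outside the bag is packed into the `pre` times just before `s` and the `post` times
    -- just after `e`, so no inactive time forfeits units in between.
    let A : ℕ → Prop := fun i => (i < s ∧ s - i ≤ pre) ∨ (D.Act i (ζ i) v) ∨ (e < i ∧ i - e ≤ post)
    have hAct : ∀ i, D.Act i (ζ i) v → s ≤ i ∧ i ≤ e := fun i hi => by
      have := (h _ _).1 hi.1.1; omega
    refine ⟨A, ?_, fun i _ hi => Or.inr (Or.inl hi), ?_⟩
    -- The lower bound for the budget stays at `M` until the activity before `s` begins, then falls
    -- by one per time. It may drop at `s` to the budget declared by the path, as `pre` is at most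
    -- `M` minus that budget, and after `e` it counts down from `post`.
    · let μ : ℕ → ℕ := fun i => if i < s then D.M - (pre - (s - i)) else
        if i ≤ e then D.before i (ζ i) v else post - (i - e - 1)
      have hA1 : ∀ i < s, (A i ↔ s - i ≤ pre) := fun i hi => by
        have := hAct i
        constructor
        · rintro (h | h | h)
          · exact h.2
          · have := this h; omega
          · omega
        · exact fun h => Or.inl ⟨hi, h⟩
      have hA2 : ∀ i, s ≤ i → i ≤ e → (A i ↔ D.Act i (ζ i) v) := fun i hi hi' => by
        constructor
        · rintro (h | h | h)
          · omega
          · exact h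
          · omega
        · exact fun h => Or.inr (Or.inl h)
      have hA3 : ∀ i, e < i → (A i ↔ i - e ≤ post) := fun i hi => by
        have := hAct i
        constructor
        · rintro (h | h | h)
          · omega
          · have := this h; omega
          · exact h.2
        · exact fun h => Or.inr (Or.inr ⟨hi, h⟩)
      have hμ1 : ∀ i < s, μ i = D.M - (pre - (s - i)) := fun i hi => if_pos hi
      have hμ2 : ∀ i, s ≤ i → i ≤ e → μ i = D.before i (ζ i) v := fun i hi hi' => by
        simp [μ, hi.not_gt, hi']
      have hμ3 : ∀ i, e < i → μ i = post - (i - e - 1) := fun i hi => by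
        simp [μ, hi.not_ge, (hse.trans hi.le).not_gt]
      have hμs : ∀ i, s ≤ i → i ≤ e → μ (i + 1) ≤ D.after i (ζ i) v := fun i hi hi' => by
        rcases hi'.lt_or_eq with hlt | rfl
        · rw [hμ2 _ (by omega) (by omega),
            IsPath.before_succ D hζ (by omega) hv ((h _ _).2 (by omega))]
        · rw [hμ3 _ i.lt_succ_self]
          simpa using hq2
      refine feasible_of_lower_bound μ ?_ ?_ ?_
      · rcases Nat.eq_zero_or_pos s with h0 | h0
        · rw [hμ2 0 (by omega) (by omega)]; exact D.before_le _ _ _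
        · rw [hμ1 0 h0]; omega
      · intro i hi hAi
        rcases lt_or_ge i s with h1 | h1
        · rw [hA1 i h1] at hAi
          rw [hμ1 i h1]
          by_cases h2 : i + 1 = s
          · rw [hμ2 (i + 1) (by omega) (by omega), h2]; omega
          · rw [hμ1 (i + 1) (by omega)]; omega
        · rcases le_or_gt i e with h2 | h2
          · rw [hA2 i h1 h2] at hAi
            have := hμs i h1 h2
            rw [after, if_pos hAi] at this
            have := hAi.1.2
            rw [hμ2 i h1 h2]
            omega
          · rw [hA3 i h2] at hAi
            rw [hμ3 i h2, hμ3 (i + 1) (by omega)]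
            omega
      · intro i hi hAi
        rcases lt_or_ge i s with h1 | h1
        · rw [hA1 i h1] at hAi
          have : μ i = D.M := by rw [hμ1 i h1]; omega
          rw [this, hMd]
          by_cases h2 : i + 1 = s
          · rw [hμ2 (i + 1) (by omega) (by omega)]; exact D.before_le _ _ _
          · rw [hμ1 (i + 1) (by omega)]; omega
        · rcases le_or_gt i e with h2 | h2
          · rw [hA2 i h1 h2] at hAi
            have := hμs i h1 h2
            rwa [after, if_neg hAi, ← hμ2 i h1 h2] at this
          · rw [hA3 i h2] at hAi
            have : μ (i + 1) = 0 := by rw [hμ3 (i + 1) (by omega)]; omega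
            rw [this]
            exact Nat.zero_le _
    · refine Nat.add_le_add_left ?_ _
      simp only [Finset.sum_boole, Nat.cast_id]
      calc pre + post = (Finset.Ico (s - pre) s ∪ Finset.Ico (e + 1) (e + 1 + post)).card := by
            rw [Finset.card_union_of_disjoint, Nat.card_Ico, Nat.card_Ico]
            · omega
            · rw [Finset.disjoint_left]
              intro i hi hi'
              simp only [Finset.mem_Ico] at hi hi'
              omega
        _ ≤ _ := Finset.card_le_card fun i hi => by
            simp only [Finset.mem_union, Finset.mem_Ico] at hi
            simp only [Finset.mem_filter, Finset.mem_range]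
            rw [InBag, h]
            refine ⟨by omega, by omega, ?_⟩
            rcases hi with hi | hi
            · exact Or.inl (by omega)
            · exact Or.inr (Or.inr (by omega))
  · have hb : ∀ i, ¬ D.InBag i v := fun i hi => hs hi.spans
    -- A vertex that is always isolated just uses up its whole budget from the beginning.
    refine ⟨fun i => i < D.M, feasible_of_lower_bound (fun i => D.M - i) (by simp) ?_ ?_,
      fun i _ hi => absurd hi.1.1 (hb i), ?_⟩
    · intro i _ hi; show D.M - (i + 1) + 1 ≤ D.M - i; omega
    · intro i _ hi
      have : D.M - (i + 1) = 0 := by omega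
      simp only [this, Nat.zero_le]
    · rw [isolatedGain, if_neg hs, Finset.sum_eq_zero fun i _ => D.vertexGain_of_not_spans hs _ _,
        add_zero]
      refine le_add_left ?_
      calc min D.T D.M = ∑ i ∈ Finset.range (min D.T D.M), 1 := by simp
        _ ≤ ∑ i ∈ Finset.range (min D.T D.M), if ¬ D.InBag i v ∧ i < D.M then 1 else 0 :=
          Finset.sum_le_sum fun i hi => by
            have := Finset.mem_range.1 hi
            rw [if_pos ⟨hb i, by omega⟩]
        _ ≤ ∑ i ∈ Finset.range D.T, if ¬ D.InBag i v ∧ i < D.M then 1 else 0 :=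
          Finset.sum_le_sum_of_subset (Finset.range_subset_range.2 (min_le_left _ _))
        _ = _ := Finset.sum_congr rfl fun i _ => by congr

/-- The dynamic program computes the maximal number of dominated temporal vertices. -/
theorem lt_table_iff_exists_activity (hT : 1 ≤ D.T) (t : ℕ) :
    t < D.table D.T 0 ↔ ∃ A : ℕ → ℕ → Prop, (∀ v < D.n, Feasible (D.ℓ + 1) D.M D.T (A v)) ∧
      t ≤ ∑ v ∈ Finset.range D.n, D.vertexScore A v := by
  have hswap : ∀ ζ : ℕ → ℕ, D.totalIsolatedGain + ∑ j ∈ Finset.range D.T, D.gain j (ζ j) =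
      ∑ v ∈ Finset.range D.n,
        (D.isolatedGain v + ∑ i ∈ Finset.range D.T, D.vertexGain i (ζ i) v) := fun ζ => by
    rw [Finset.sum_add_distrib, Finset.sum_comm]; rfl
  rw [D.lt_table_iff hT]
  constructor
  · rintro ⟨ζ, hζ, ht⟩
    -- Feasibility concerns one vertex at a time, so the activities can be chosen independently.
    have hex : ∀ v, ∃ A : ℕ → Prop, v < D.n → _ := fun v => by
      by_cases hv : v < D.n
      · obtain ⟨A, hA⟩ := IsPath.exists_activity D hζ hv
        exact ⟨A, fun _ => hA⟩
      · exact ⟨fun _ => True, fun h => absurd h hv⟩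
    choose A hA using hex
    refine ⟨A, fun v hv => (hA v hv).1, ht.trans ?_⟩
    rw [hswap]
    refine Finset.sum_le_sum fun v hv => ?_
    rw [Finset.mem_range] at hv
    refine (hA v hv).2.2.trans ?_
    rw [← Finset.sum_add_distrib]
    refine Finset.sum_le_sum fun i hi => ?_
    rw [Finset.mem_range] at hi
    -- In the bag, the dominating vertex of the configuration is active in its own chosen activity;
    -- outside the bag, `v` dominates itself.
    by_cases hb : D.InBag i v
    · by_cases hd : D.Dom i (ζ i) v
      · have : D.DomBy A v i := by
          obtain ⟨u, hu, hu', huv⟩ := hd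
          exact ⟨u, hu, (hA u hu).2.1 i hi hu', huv⟩
        simp [hb, hd, this]
      · simp [hb, hd]
    · by_cases hd : A v i
      · have : D.DomBy A v i := ⟨v, hv, hd, Or.inl rfl⟩
        simp [hb, hd, this]
      · simp [hb, hd]
  · rintro ⟨A, hA, ht⟩
    refine ⟨D.configOf A, D.isPath_configOf hA, ht.trans ?_⟩
    rw [hswap]
    exact Finset.sum_le_sum fun v hv => D.vertexScore_le hA (Finset.mem_range.1 hv)

end TimelineInstance

/-! ### Temporal graphs as instances with numbered vertices and times. -/

namespace TemporalGraph

variable {n T : ℕ} (𝒢 : TemporalGraph (Fin n) T) (k ℓ : ℕ)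

/-- The instance given by a temporal graph. -/
def toInstance : TimelineInstance where
  n := n
  T := T
  k := k
  ℓ := ℓ
  adj p u v := ∃ (hp : p < T) (hu : u < n) (hv : v < n), (𝒢 ⟨p, hp⟩).Adj ⟨u, hu⟩ ⟨v, hv⟩
  symm := fun ⟨hp, hu, hv, h⟩ => ⟨hp, hv, hu, h.symm⟩
  lt := fun ⟨hp, hu, hv, _⟩ => ⟨hp, hu, hv⟩

theorem toInstance_adj (p : Fin T) (u v : Fin n) :
    (𝒢.toInstance k ℓ).adj p u v ↔ (𝒢 p).Adj u v :=
  ⟨fun ⟨_, _, _, h⟩ => h, fun h => ⟨p.2, u.2, v.2, h⟩⟩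

open Classical in
theorem one_le_degree_iff (p : Fin T) (v : Fin n) :
    1 ≤ (𝒢 p).degree v ↔ (𝒢.toInstance k ℓ).NonIsolated p v := by
  rw [Nat.succ_le_iff, SimpleGraph.degree_pos_iff_exists_adj]
  constructor
  · rintro ⟨u, hu⟩
    exact ⟨u, u.2, (toInstance_adj 𝒢 k ℓ p u v).2 hu.symm⟩
  · rintro ⟨u, hu, h⟩
    exact ⟨⟨u, hu⟩, ((toInstance_adj 𝒢 k ℓ p ⟨u, hu⟩ v).1 h).symm⟩

theorem mem_bag_iff (i : Fin T) (v : Fin n) :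
    v ∈ bag 𝒢 i ↔ (𝒢.toInstance k ℓ).InBag i v := by
  classical
  simp only [bag, Finset.mem_filter, Finset.mem_univ, true_and]
  constructor
  · rintro ⟨p, q, hp, hq, h1, h2⟩
    exact ⟨⟨p, Nat.lt_succ_of_le hp, (one_le_degree_iff 𝒢 k ℓ p v).1 (by convert h1)⟩,
      q, q.2, hq, (one_le_degree_iff 𝒢 k ℓ q v).1 (by convert h2)⟩
  · rintro ⟨⟨p, hp, h1⟩, q, hq, hq', h2⟩
    refine ⟨⟨p, h1.lt⟩, ⟨q, hq⟩, Nat.le_of_lt_succ hp, hq', ?_, ?_⟩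
    · convert (one_le_degree_iff 𝒢 k ℓ ⟨p, h1.lt⟩ v).2 h1
    · convert (one_le_degree_iff 𝒢 k ℓ ⟨q, hq⟩ v).2 h2

/-- There is one digit for each bag vertex, and the radix satisfies `C = 2 (k (ℓ + 1) + 1) ≤ ((k +
1) (ℓ + 2)) ^ 2`. -/
theorem numConfigs_le (i : ℕ) (hi : i < T) :
    (𝒢.toInstance k ℓ).numConfigs i ≤ ((k + 1) * (ℓ + 2)) ^ (2 * vimw 𝒢) := by
  classical
  have hcard : ((Finset.range n).filter ((𝒢.toInstance k ℓ).InBag i)).card ≤ vimw 𝒢 := by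
    refine le_trans (le_of_eq ?_) (Finset.le_sup (f := fun i => (bag 𝒢 i).card)
      (Finset.mem_univ (⟨i, hi⟩ : Fin T)))
    refine (Finset.card_bij (fun (v : Fin n) _ => (v : ℕ)) (fun v hv => ?_)
      (fun v _ v' _ h => ?_) fun v hv => ?_).symm
    · simp only [Finset.mem_filter, Finset.mem_range]
      exact ⟨v.2, (mem_bag_iff 𝒢 k ℓ ⟨i, hi⟩ v).1 hv⟩
    · exact Fin.ext h
    · simp only [Finset.mem_filter, Finset.mem_range] at hv
      exact ⟨⟨v, hv.1⟩, (mem_bag_iff 𝒢 k ℓ ⟨i, hi⟩ ⟨v, hv.1⟩).2 hv.2, rfl⟩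
  have hC : (𝒢.toInstance k ℓ).C ≤ ((k + 1) * (ℓ + 2)) ^ 2 := by
    show 2 * (k * (ℓ + 1) + 1) ≤ _
    nlinarith [Nat.zero_le (k * ℓ), Nat.zero_le (k * k), Nat.zero_le (ℓ * ℓ),
      Nat.zero_le (k * k * ℓ * ℓ), Nat.zero_le (k * k * ℓ), Nat.zero_le (k * ℓ * ℓ)]
  rw [TimelineInstance.numConfigs, digitWeight_eq_pow, pow_mul]
  refine le_trans (le_of_eq ?_) ((Nat.pow_le_pow_right (TimelineInstance.C_pos _) hcard).trans
    (Nat.pow_le_pow_left hC _))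
  congr!

open Classical in
theorem sum_vertexScore (A : ℕ → ℕ → Prop) :
    ∑ v ∈ Finset.range n, (𝒢.toInstance k ℓ).vertexScore A v =
      (Finset.univ.filter fun x : Fin n × Fin T =>
        (𝒢.toInstance k ℓ).DomBy A x.1 x.2).card := by
  rw [Finset.card_filter, Fintype.sum_prod_type, Finset.sum_range]
  refine Finset.sum_congr rfl fun v _ => ?_
  exact Finset.sum_range _

/-- Domination depends only on the active times. A timeline yields feasible ones; a feasible
activity is covered by a timeline, which may be active more often but then dominates no less. -/
theorem timelinePDS_iff (t : ℕ) : TimelinePDS 𝒢 k ℓ t ↔ ∃ A : ℕ → ℕ → Prop,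
    (∀ v < n, Feasible (ℓ + 1) (k * (ℓ + 1)) T (A v)) ∧
      t ≤ ∑ v ∈ Finset.range n, (𝒢.toInstance k ℓ).vertexScore A v := by
  classical
  simp only [sum_vertexScore]
  constructor
  · rintro ⟨𝒯, ⟨h1, h2⟩, ht⟩
    refine ⟨fun v i => ∃ (hv : v < n) (hi : i < T), IsActive 𝒯 ⟨v, hv⟩ ⟨i, hi⟩, fun v hv => ?_,
      ht.trans (Finset.card_le_card fun x hx => ?_)⟩
    · have := feasible_of_intervals (T := T) (𝒯.filter fun x => x.1 = ⟨v, hv⟩)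
        (fun x => (x.2.1 : ℕ)) (fun x => (x.2.2 : ℕ)) (k := k) (ℓ := ℓ) ?_ ?_
      · convert this using 2 with i
        constructor
        · rintro ⟨_, hi, a, b, hab, ha, hb⟩
          exact ⟨(⟨v, hv⟩, a, b), by simpa using hab, ha, hb⟩
        · rintro ⟨⟨u, a, b⟩, hx, ha, hb⟩
          simp only [Finset.mem_filter] at hx
          obtain ⟨hx, rfl⟩ := hx
          exact ⟨hv, hb.trans_lt b.2, a, b, hx, ha, hb⟩
      · convert h2 ⟨v, hv⟩
      · rintro ⟨u, a, b⟩ hx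
        exact (h1 u a b (Finset.mem_filter.1 hx).1).2
    · simp only [Finset.mem_filter, Finset.mem_univ, true_and] at hx ⊢
      obtain ⟨u, hu, huv⟩ := hx
      refine ⟨u, u.2, ⟨u.2, x.2.2, hu⟩, ?_⟩
      rcases huv with h | h
      · exact Or.inl (by rw [h])
      · exact Or.inr ((toInstance_adj 𝒢 k ℓ _ _ _).2 h)
  · rintro ⟨A, hA, ht⟩
    have hS : ∀ v : Fin n, ∃ S : Finset ℕ, (∀ s ∈ S, s < T) ∧ S.card ≤ k ∧
        ∀ i < T, A v i → ∃ s ∈ S, s ≤ i ∧ i ≤ s + ℓ := fun v => (hA v v.2).exists_starts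
    choose S hS1 hS2 hS3 using hS
    -- Every start gets an interval of maximal length, cut off at the last time. The end is a
    -- function of the start, so a vertex has at most as many triples as starts.
    let 𝒯 : Finset (Fin n × Fin T × Fin T) := Finset.univ.filter fun x =>
      (x.2.1 : ℕ) ∈ S x.1 ∧ (x.2.2 : ℕ) = min (x.2.1 + ℓ) (T - 1)
    have h𝒯 : ∀ v a b, (v, a, b) ∈ 𝒯 ↔ (a : ℕ) ∈ S v ∧ (b : ℕ) = min (a + ℓ) (T - 1) := by
      intro v a b; simp [𝒯]
    refine ⟨𝒯, ⟨fun v a b h => ?_, fun v => ?_⟩, ht.trans (Finset.card_le_card fun x hx => ?_)⟩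
    · obtain ⟨-, hb⟩ := (h𝒯 v a b).1 h
      have := a.2
      refine ⟨Fin.le_def.2 ?_, ?_⟩ <;> omega
    · refine le_trans (Finset.card_le_card_of_injOn (fun x => (x.2.1 : ℕ)) ?_ ?_) (hS2 v)
      · rintro ⟨u, a, b⟩ hx
        simp only [Finset.coe_filter, Set.mem_ofPred_eq, h𝒯] at hx
        obtain ⟨hx, rfl⟩ := hx
        exact hx.1
      · rintro ⟨u, a, b⟩ hx ⟨u', a', b'⟩ hx' haa
        simp only [Finset.coe_filter, Set.mem_ofPred_eq, h𝒯] at hx hx' haa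
        obtain ⟨hx, rfl⟩ := hx
        obtain ⟨hx', rfl⟩ := hx'
        obtain rfl := Fin.ext haa
        obtain rfl : b = b' := Fin.ext (hx.2.trans hx'.2.symm)
        rfl
    · simp only [Finset.mem_filter, Finset.mem_univ, true_and] at hx ⊢
      obtain ⟨u, hu, hAu, huv⟩ := hx
      obtain ⟨s, hs, hs1, hs2⟩ := hS3 ⟨u, hu⟩ x.2 x.2.2 hAu
      have hx2 := x.2.2
      refine ⟨⟨u, hu⟩, ⟨⟨s, by omega⟩, ⟨min (s + ℓ) (T - 1), by omega⟩, (h𝒯 _ _ _).2 ⟨hs, rfl⟩,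
        Fin.le_def.2 hs1, Fin.le_def.2 ?_⟩, ?_⟩
      · show (x.2 : ℕ) ≤ min (s + ℓ) (T - 1)
        omega
      · rcases huv with h | h
        · exact Or.inl (Fin.ext h.symm)
        · exact Or.inr ((toInstance_adj 𝒢 k ℓ x.2 ⟨u, hu⟩ x.1).1 h)

theorem timelinePDS_iff_lt_table (hT : 1 ≤ T) (t : ℕ) :
    TimelinePDS 𝒢 k ℓ t ↔ t < (𝒢.toInstance k ℓ).table T 0 :=
  (timelinePDS_iff 𝒢 k ℓ t).trans
    (TimelineInstance.lt_table_iff_exists_activity (𝒢.toInstance k ℓ) hT t).symm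

theorem timelineDS_iff : TimelineDS 𝒢 k ℓ ↔ TimelinePDS 𝒢 k ℓ (n * T) := by
  classical
  refine exists_congr fun 𝒯 => and_congr_right fun _ => ?_
  have hcard : (Finset.univ : Finset (Fin n × Fin T)).card = n * T := by simp
  constructor
  · intro h
    rw [Finset.filter_true_of_mem fun x _ => h x.1 x.2, hcard]
  · intro h v i
    have := Finset.eq_of_subset_of_card_le (Finset.filter_subset _ _) (hcard.le.trans h)
    have hmem := this ▸ Finset.mem_univ (v, i)
    exact (Finset.mem_filter.1 hmem).2

end TemporalGraph

namespace WordRAM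

/-! ## Renaming of variables, and truth values -/

/-- Rename the variables of a term. -/
def Tm.rename : (ℕ → ℕ) → Tm → Tm
  | _, .const m => .const m
  | f, .var i => .var (f i)
  | f, .load a => .load (a.rename f)
  | f, .bin o a b => .bin o (a.rename f) (b.rename f)
  | f, .ite c a b => .ite (c.rename f) (a.rename f) (b.rename f)
  | f, .fold o init bound body =>
    .fold o init (bound.rename f) (body.rename (scons 0 fun i => f i + 1))

/-- The term with all variables shifted, for use below a binder. -/
def Tm.lift (e : Tm) : Tm := e.rename Nat.succ

/-- Renaming only changes which registers are read, so terms can be moved below binders without any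
change of value or cost. -/
theorem Tm.compile_rename (e : Tm) : ∀ (f ρ : ℕ → ℕ) (d : ℕ),
    (e.rename f).compile ρ d = e.compile (ρ ∘ f) d := by
  induction e with
  | const m => intros; rfl
  | var i => intros; rfl
  | load a ha => intro f ρ d; simp only [rename, compile, ha]
  | bin o a b ha hb => intro f ρ d; simp only [rename, compile, ha, hb]
  | ite c a b hc ha hb => intro f ρ d; simp only [rename, compile, ha, hb, hc]
  | fold o init a b ha hb =>
    intro f ρ d
    have : scons (d + 2) ρ ∘ scons 0 (fun i => f i + 1) = scons (d + 2) (ρ ∘ f) := by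
      funext i; cases i <;> rfl
    simp only [rename, compile, ha, hb, this]

theorem Tm.cost_rename (R : ℕ) (e : Tm) : ∀ f : ℕ → ℕ, (e.rename f).cost R = e.cost R := by
  induction e with
  | const m => intros; rfl
  | var i => intros; rfl
  | load a ha => intro f; simp only [rename, cost, ha]
  | bin o a b ha hb => intro f; simp only [rename, cost, ha, hb]
  | ite c a b hc ha hb => intro f; simp only [rename, cost, ha, hb, hc]
  | fold o init a b ha hb => intro f; simp only [rename, cost, ha, hb]

section Rules

variable {w R : ℕ} {mem env : ℕ → ℕ}

theorem Ev.lift {e : Tm} {v : ℕ} (h : Ev w R mem env e v) (x : ℕ) :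
    Ev w R mem (scons x env) e.lift v := by
  intro ρ d s hρ hmem henv
  rw [Tm.lift, Tm.compile_rename, Tm.cost_rename]
  exact h (ρ ∘ Nat.succ) d s (fun i => hρ _) hmem fun i => henv (i + 1)

theorem Ev.var_zero (x : ℕ) : Ev w R mem (scons x env) (.var 0) x := Ev.var 0

open Classical in
/-- The truth value of a proposition. -/
noncomputable def truth (P : Prop) : ℕ := if P then 1 else 0

theorem truth_of {P : Prop} (h : P) : truth P = 1 := if_pos h

theorem truth_of_not {P : Prop} (h : ¬ P) : truth P = 0 := if_neg h

theorem truth_congr {P Q : Prop} (h : P ↔ Q) : truth P = truth Q := by rw [propext h]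

theorem truth_le (P : Prop) : truth P ≤ 1 := by
  unfold truth; split_ifs <;> omega

theorem truth_ne_zero {P : Prop} : truth P ≠ 0 ↔ P := by
  unfold truth; split_ifs with h <;> simp [h]

theorem truth_eq_zero {P : Prop} : truth P = 0 ↔ ¬ P := by
  unfold truth; split_ifs with h <;> simp [h]

/-- Whether some index below `bound` satisfies `body`. -/
def Tm.any (bound body : Tm) : Tm := .bin .lt (.const 0) (.fold .add 0 bound body)

/-- Conjunction. -/
def Tm.and (a b : Tm) : Tm := .ite a b (.const 0)

/-- Disjunction. -/
def Tm.or (a b : Tm) : Tm := .ite a (.const 1) b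

/-- Minimum. -/
def Tm.min (a b : Tm) : Tm := .ite (.bin .lt a b) a b

/-- Maximum. -/
def Tm.max (a b : Tm) : Tm := .ite (.bin .lt a b) b a

theorem Ev.truth_lt {a b : Tm} {x y : ℕ} (hw : 0 < w) (ha : Ev w R mem env a x)
    (hb : Ev w R mem env b y) : Ev w R mem env (.bin .lt a b) (truth (x < y)) :=
  (Ev.lt hw ha hb).congr (by unfold truth; congr)

theorem Ev.truth_eq {a b : Tm} {x y : ℕ} (hw : 0 < w) (ha : Ev w R mem env a x)
    (hb : Ev w R mem env b y) : Ev w R mem env (.bin .eq a b) (truth (x = y)) :=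
  (Ev.eq hw ha hb).congr (by unfold truth; congr)

theorem Ev.ite_truth {c a b : Tm} {P : Prop} [Decidable P] {x y : ℕ}
    (hc : Ev w R mem env c (truth P)) (ha : P → Ev w R mem env a x)
    (hb : ¬ P → Ev w R mem env b y) : Ev w R mem env (.ite c a b) (if P then x else y) := by
  refine hc.ite (fun h => ?_) fun h => ?_
  · rw [if_pos (truth_ne_zero.1 h)]; exact ha (truth_ne_zero.1 h)
  · rw [if_neg (truth_eq_zero.1 h)]; exact hb (truth_eq_zero.1 h)

theorem Ev.zero : Ev w R mem env (.const 0) 0 := Ev.const (by positivity)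

theorem Ev.one (hw : 0 < w) : Ev w R mem env (.const 1) 1 := Ev.const (Nat.one_lt_two_pow hw.ne')

theorem Ev.and {a b : Tm} {P Q : Prop} (ha : Ev w R mem env a (truth P))
    (hb : P → Ev w R mem env b (truth Q)) : Ev w R mem env (a.and b) (truth (P ∧ Q)) := by
  refine ha.ite (fun h => ?_) fun h => ?_
  · rw [truth_ne_zero] at h
    rw [truth_congr (and_iff_right h)]; exact hb h
  · rw [truth_eq_zero] at h
    rw [truth_of_not fun h' => h h'.1]; exact Ev.zero

theorem Ev.or {a b : Tm} {P Q : Prop} (hw : 0 < w) (ha : Ev w R mem env a (truth P))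
    (hb : Ev w R mem env b (truth Q)) : Ev w R mem env (a.or b) (truth (P ∨ Q)) := by
  refine ha.ite (fun h => ?_) fun h => ?_
  · rw [truth_ne_zero] at h
    rw [truth_of (Or.inl h)]; exact Ev.one hw
  · rw [truth_eq_zero] at h
    rw [truth_congr (or_iff_right h)]; exact hb

theorem Ev.min {a b : Tm} {x y : ℕ} (hw : 0 < w) (ha : Ev w R mem env a x)
    (hb : Ev w R mem env b y) : Ev w R mem env (a.min b) (min x y) := by
  refine ((Ev.truth_lt hw ha hb).ite_truth (fun _ => ha) fun _ => hb).congr ?_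
  split_ifs <;> omega

theorem Ev.max {a b : Tm} {x y : ℕ} (hw : 0 < w) (ha : Ev w R mem env a x)
    (hb : Ev w R mem env b y) : Ev w R mem env (a.max b) (max x y) := by
  refine ((Ev.truth_lt hw ha hb).ite_truth (fun _ => hb) fun _ => ha).congr ?_
  split_ifs <;> omega

theorem Ev.any {bound body : Tm} {n : ℕ} (hw : 0 < w) (hR : R < 2 ^ w)
    (hb : Ev w R mem env bound n) (hn : n ≤ R) (P : ℕ → Prop)
    (h : ∀ j < n, Ev w R mem (scons j env) body (truth (P j))) :
    Ev w R mem env (bound.any body) (truth (∃ j < n, P j)) := by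
  have hle : ∑ j ∈ Finset.range n, truth (P j) ≤ n :=
    (Finset.sum_le_sum fun j _ => truth_le (P j)).trans (by simp)
  refine (Ev.truth_lt hw Ev.zero
    (Ev.sum hw hR hb hn (fun j => truth (P j)) h (by omega))).congr (truth_congr ?_)
  rw [Nat.pos_iff_ne_zero, Ne, Finset.sum_eq_zero_iff]
  simp only [Finset.mem_range, truth_eq_zero, not_forall, not_not, exists_prop]

end Rules

end WordRAM

/-! ## Terms for the dynamic program -/

namespace TimelineInstance

open WordRAM

/-- The memory contains the instance. -/
structure Encoded (D : TimelineInstance) (mem : ℕ → ℕ) : Prop where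
  n : mem 0 = D.n
  T : mem 1 = D.T
  k : mem 2 = D.k
  ℓ : mem 3 = D.ℓ
  adj : ∀ p < D.T, ∀ u < D.n, ∀ v < D.n, mem (4 + ((p * D.n + u) * D.n + v)) = truth (D.adj p u v)

/-- The numbers of the instance are at most `Q`, and `Q ^ 5` fits into a word. -/
structure Fits (D : TimelineInstance) (w Q : ℕ) : Prop where
  eight_le : 8 ≤ Q
  pow_le : Q ^ 5 ≤ 2 ^ w
  n_le : D.n ≤ Q
  T_le : D.T ≤ Q
  k_le : D.k ≤ Q
  ℓ_le : D.ℓ ≤ Q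
  size_le : ∀ i < D.T, D.numConfigs i ≤ Q

/-- The value of a term is computed with at most `n + T` rounds of each iteration. -/
abbrev Computes (D : TimelineInstance) (w : ℕ) (mem env : ℕ → ℕ) (e : Tm) (v : ℕ) : Prop :=
  Ev w (D.n + D.T) mem env e v

/-- The term for `n`. -/
def tN : Tm := .load (.const 0)
/-- The term for `T`. -/
def tT : Tm := .load (.const 1)
/-- The term for `ℓ + 1`. -/
def tL : Tm := .bin .add (.load (.const 3)) (.const 1)
/-- The term for `M`. -/
def tM : Tm := .bin .mul (.load (.const 2)) tL
/-- The term for `C`. -/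
def tC : Tm := .bin .mul (.const 2) (.bin .add tM (.const 1))
/-- The term for `i + 1`. -/
def tSucc (i : Tm) : Tm := .bin .add i (.const 1)
/-- The term for `T - 1 - i`. -/
def tRev (i : Tm) : Tm := .bin .sub (.bin .sub tT (.const 1)) i
/-- The term for `adj`. -/
def tAdj (p u v : Tm) : Tm :=
  .load (.bin .add (.const 4) (.bin .add (.bin .mul (.bin .add (.bin .mul p tN) u) tN) v))
/-- The term for `NonIsolated`. -/
def tNonIsolated (p v : Tm) : Tm := tN.any (tAdj p.lift (.var 0) v.lift)
/-- The term for `Spans`. -/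
def tSpans (a b v : Tm) : Tm :=
  (a.any (tNonIsolated (.var 0) v.lift)).and
    ((Tm.bin .sub tT b).any (tNonIsolated (tRev (.var 0)) v.lift))
/-- The term for `digitWeight`. -/
def tWeight (a b v : Tm) : Tm :=
  .fold .mul 1 v (.ite (tSpans a.lift b.lift (.var 0)) tC (.const 1))
/-- The term for `encodeDigits`. -/
def tEncode (a b f : Tm) : Tm :=
  .fold .add 0 tN (.ite (tSpans a.lift b.lift (.var 0))
    (.bin .mul f (tWeight a.lift b.lift (.var 0))) (.const 0))
/-- The term for `numConfigs`. -/
def tNumConfigs (i : Tm) : Tm := tWeight (tSucc i) i tN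
/-- The term for `digit`. -/
def tDigit (i z v : Tm) : Tm := .bin .mod (.bin .div z (tWeight (tSucc i) i v)) tC
/-- The term for `before`. -/
def tBefore (i z v : Tm) : Tm := .bin .div (tDigit i z v) (.const 2)
/-- The term for `Act`. -/
def tAct (i z v : Tm) : Tm :=
  ((tSpans (tSucc i) i v).and (.bin .lt (.const 0) (tBefore i z v))).and
    (.bin .eq (.bin .mod (tDigit i z v) (.const 2)) (.const 1))
/-- The term for `after`. -/
def tAfter (i z v : Tm) : Tm :=
  .ite (tAct i z v) (.bin .sub (tBefore i z v) (.const 1))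
    (.bin .mul (.bin .div (tBefore i z v) tL) tL)
/-- The term for `source`. -/
def tSource (i z : Tm) : Tm := tEncode i i (tBefore i.lift z.lift (.var 0))
/-- The term for `target`. -/
def tTarget (i z : Tm) : Tm := tEncode (tSucc i) (tSucc i) (tAfter i.lift z.lift (.var 0))
/-- The term for `Dom`. -/
def tDom (i z v : Tm) : Tm :=
  tN.any ((tAct i.lift z.lift (.var 0)).and
    (Tm.or (.bin .eq (.var 0) v.lift) (tAdj i.lift (.var 0) v.lift)))
/-- The term for `vertexGain`. -/
def tVertexGain (i z v : Tm) : Tm :=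
  .ite (tSpans (tSucc i) i v)
    (.bin .add (tDom i z v)
      (.bin .add (.ite (tSpans i i v) (.const 0) (i.min (.bin .sub tM (tBefore i z v))))
        (.ite (tSpans (tSucc i) (tSucc i) v) (.const 0) ((tRev i).min (tAfter i z v)))))
    (.const 0)
/-- The term for `gain`. -/
def tGain (i z : Tm) : Tm := .fold .add 0 tN (tVertexGain i.lift z.lift (.var 0))
/-- The term for `totalIsolatedGain`. -/
def tIsolatedGain : Tm :=
  .fold .add 0 tN (.ite (tSpans tT (.const 0) (.var 0)) (.const 0) (tT.min tM))

/-! ### Correctness of the terms and absence of overflow. -/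

section

variable {D : TimelineInstance} {w Q : ℕ} {mem env : ℕ → ℕ}

/-- This is the common overflow test: `6 * Q ^ 4` leaves room for sums of a few quantities of degree
at most four, and `8 ≤ Q` absorbs the factor into `Q ^ 5`. -/
theorem Fits.lt_of_le (hF : D.Fits w Q) {x : ℕ} (h : x ≤ 6 * Q ^ 4) : x < 2 ^ w := by
  have h1 : 0 < Q ^ 4 := Nat.pow_pos (by linarith [hF.eight_le])
  calc x ≤ 6 * Q ^ 4 := h
    _ < 8 * Q ^ 4 := by omega
    _ ≤ Q * Q ^ 4 := Nat.mul_le_mul_right _ hF.eight_le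
    _ = Q ^ 5 := by ring
    _ ≤ 2 ^ w := hF.pow_le

theorem Fits.pow_le_pow (hF : D.Fits w Q) {a b : ℕ} (h : a ≤ b) : Q ^ a ≤ Q ^ b :=
  Nat.pow_le_pow_right (by linarith [hF.eight_le]) h

theorem Fits.le_pow_four (hF : D.Fits w Q) : Q ≤ Q ^ 4 :=
  (pow_one Q).symm.le.trans (hF.pow_le_pow (by norm_num))

theorem Fits.w_pos (hF : D.Fits w Q) : 0 < w := by
  rcases Nat.eq_zero_or_pos w with rfl | h
  · have : 1 < 2 ^ 0 := hF.lt_of_le (by linarith [hF.le_pow_four, hF.eight_le])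
    simp at this
  · exact h

theorem Fits.rounds_lt (hF : D.Fits w Q) : D.n + D.T < 2 ^ w :=
  hF.lt_of_le (by linarith [hF.le_pow_four, hF.n_le, hF.T_le])

theorem Fits.L_le (hF : D.Fits w Q) : D.ℓ + 1 ≤ 2 * Q := by
  linarith [hF.ℓ_le, hF.eight_le]

theorem Fits.M_le (hF : D.Fits w Q) : D.M ≤ 2 * Q ^ 2 :=
  (Nat.mul_le_mul hF.k_le hF.L_le).trans (by ring_nf; rfl)

theorem Fits.sq_le (hF : D.Fits w Q) : Q ^ 2 * 64 ≤ Q ^ 4 := by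
  have h := Nat.mul_le_mul_left (Q ^ 2) (Nat.mul_le_mul hF.eight_le hF.eight_le)
  calc Q ^ 2 * 64 = Q ^ 2 * (8 * 8) := by norm_num
    _ ≤ Q ^ 2 * (Q * Q) := h
    _ = Q ^ 4 := by ring

theorem Fits.const_lt (hF : D.Fits w Q) {m : ℕ} (hm : m ≤ 8) : m < 2 ^ w :=
  hF.lt_of_le (by linarith [hF.le_pow_four, hF.eight_le])

theorem carried_inBag {i v : ℕ} (h : D.Carried i v) : D.InBag i v :=
  ⟨h.1.imp fun _ hp => ⟨hp.1.trans i.lt_succ_self, hp.2⟩, h.2⟩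

theorem carried_succ_inBag {i v : ℕ} (h : D.Carried (i + 1) v) : D.InBag i v :=
  ⟨h.1, h.2.imp fun _ hq => ⟨hq.1, i.le_succ.trans hq.2.1, hq.2.2⟩⟩

/-- Carried vertices belong to the adjacent bags, so codes of carried budgets are bounded by the
number of configurations and need no size bound of their own. -/
theorem digitWeight_le_numConfigs {P : ℕ → Prop} {i v : ℕ} (hP : ∀ u, P u → D.InBag i u)
    (hv : v ≤ D.n) : digitWeight P D.C v ≤ D.numConfigs i := by
  classical
  refine le_trans (Finset.prod_le_prod' fun u _ => ?_)
    (Nat.le_of_dvd (digitWeight_pos D.C_pos _) (digitWeight_dvd hv))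
  have := D.C_pos
  split_ifs with h1 h2
  · exact le_rfl
  · exact absurd (hP u h1) h2
  · omega
  · exact le_rfl

theorem encodeDigits_lt_numConfigs {P : ℕ → Prop} {i : ℕ} (hP : ∀ u, P u → D.InBag i u)
    {f : ℕ → ℕ} (hf : ∀ v < D.n, P v → f v < D.C) :
    encodeDigits P D.C D.n f < D.numConfigs i :=
  (encodeDigits_lt hf).trans_le (digitWeight_le_numConfigs hP le_rfl)

theorem source_lt (i z : ℕ) : D.source i z < D.numConfigs i :=
  encodeDigits_lt_numConfigs (fun _ => carried_inBag) fun _ _ _ =>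
    (D.before_le _ _ _).trans_lt D.M_lt_C

theorem target_lt (i z : ℕ) : D.target i z < D.numConfigs i :=
  encodeDigits_lt_numConfigs (fun _ => carried_succ_inBag) fun _ _ _ =>
    ((D.after_le_before _ _ _).trans (D.before_le _ _ _)).trans_lt D.M_lt_C

theorem vertexGain_le {i : ℕ} (hi : i < D.T) (z v : ℕ) : D.vertexGain i z v ≤ 2 * D.T := by
  unfold vertexGain
  split_ifs <;> omega

theorem gain_le {i : ℕ} (hi : i < D.T) (z : ℕ) : D.gain i z ≤ D.n * (2 * D.T) :=
  (Finset.sum_le_sum fun v _ => vertexGain_le hi z v).trans (by simp)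

theorem totalIsolatedGain_le : D.totalIsolatedGain ≤ D.n * D.T := by
  refine (Finset.sum_le_sum (g := fun _ => D.T) fun v _ => ?_).trans (by simp)
  unfold isolatedGain
  split_ifs <;> omega

theorem table_le (i : ℕ) (hi : i ≤ D.T) (y : ℕ) :
    D.table i y ≤ 1 + D.n * D.T + i * (D.n * (2 * D.T)) := by
  induction i generalizing y with
  | zero =>
    have := D.totalIsolatedGain_le
    unfold table
    split_ifs <;> omega
  | succ i ih =>
    refine Finset.sup_le fun z _ => ?_
    have h1 := ih (by omega) (D.source i z)
    have h2 := gain_le (D := D) (i := i) (by omega) z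
    have h3 : (i + 1) * (D.n * (2 * D.T)) = i * (D.n * (2 * D.T)) + D.n * (2 * D.T) := by ring
    split_ifs <;> omega

theorem Fits.table_bound (hF : D.Fits w Q) :
    1 + D.n * D.T + D.T * (D.n * (2 * D.T)) + 1 ≤ Q ^ 4 := by
  have h1 := Nat.mul_le_mul hF.n_le hF.T_le
  have h2 := Nat.mul_le_mul hF.T_le (Nat.mul_le_mul hF.n_le (Nat.mul_le_mul_left 2 hF.T_le))
  have h3 : Q * (Q * (2 * Q)) = 2 * Q ^ 3 := by ring
  have h4 : 8 * Q ^ 3 ≤ Q ^ 4 := by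
    calc 8 * Q ^ 3 ≤ Q * Q ^ 3 := Nat.mul_le_mul_right _ hF.eight_le
      _ = Q ^ 4 := by ring
  have h5 := hF.sq_le
  have h6 := hF.eight_le
  nlinarith

variable (hF : D.Fits w Q) (hm : D.Encoded mem)
include hF hm

omit hm in
theorem computes_const {m : ℕ} (h : m ≤ 8) : D.Computes w mem env (.const m) m :=
  Ev.const (hF.const_lt h)

omit hF in
theorem computes_n : D.Computes w mem env tN D.n :=
  (Ev.load Ev.zero).congr hm.n

theorem computes_T : D.Computes w mem env tT D.T :=
  (Ev.load (Ev.one hF.w_pos)).congr hm.T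

theorem computes_L : D.Computes w mem env tL (D.ℓ + 1) :=
  Ev.add ((Ev.load (computes_const hF (by norm_num))).congr hm.ℓ) (Ev.one hF.w_pos)
    (hF.lt_of_le (by linarith [hF.L_le, hF.le_pow_four]))

theorem computes_M : D.Computes w mem env tM D.M :=
  Ev.mul ((Ev.load (computes_const hF (by norm_num))).congr hm.k) (computes_L hF hm)
    (hF.lt_of_le (by
      have := hF.M_le
      rw [M] at this
      have := hF.sq_le
      omega))

theorem computes_C : D.Computes w mem env tC D.C := by
  have h1 := hF.M_le
  have h2 := hF.sq_le
  have h3 := hF.le_pow_four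
  have h4 := hF.eight_le
  refine Ev.mul (computes_const hF (by norm_num))
    (Ev.add (computes_M hF hm) (Ev.one hF.w_pos) (hF.lt_of_le ?_)) (hF.lt_of_le ?_) <;> linarith

omit hm in
theorem computes_succ {ti : Tm} {i : ℕ} (hti : D.Computes w mem env ti i) (hi : i ≤ D.T) :
    D.Computes w mem env (tSucc ti) (i + 1) :=
  Ev.add hti (Ev.one hF.w_pos)
    (hF.lt_of_le (by linarith [hF.T_le, hF.le_pow_four, hF.eight_le]))

theorem computes_rev {ti : Tm} {i : ℕ} (hti : D.Computes w mem env ti i) :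
    D.Computes w mem env (tRev ti) (D.T - 1 - i) :=
  Ev.sub (Ev.sub (computes_T hF hm) (Ev.one hF.w_pos)) hti

theorem computes_adj {tp tu tv : Tm} {p u v : ℕ} (hp : D.Computes w mem env tp p)
    (hu : D.Computes w mem env tu u) (hv : D.Computes w mem env tv v) (hpT : p < D.T)
    (hun : u < D.n) (hvn : v < D.n) :
    D.Computes w mem env (tAdj tp tu tv) (truth (D.adj p u v)) := by
  have h1 : p * D.n ≤ Q ^ 2 := (Nat.mul_le_mul (hpT.le.trans hF.T_le) hF.n_le).trans (by rw [sq])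
  have h2 : (p * D.n + u) * D.n ≤ Q ^ 2 * Q := by
    refine Nat.mul_le_mul ?_ hF.n_le
    have h : (p + 1) * D.n ≤ Q * Q := Nat.mul_le_mul (Nat.succ_le_of_lt hpT |>.trans hF.T_le) hF.n_le
    nlinarith
  have h3 : Q ^ 2 * Q = Q ^ 3 := by ring
  have h4 := hF.pow_le_pow (show 3 ≤ 4 by norm_num)
  have h5 := hF.pow_le_pow (show 2 ≤ 4 by norm_num)
  have h6 := hF.le_pow_four
  have h7 := hF.n_le
  have h8 := hF.eight_le
  refine (Ev.load (Ev.add (computes_const hF (by norm_num)) (Ev.add (Ev.mul (Ev.add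
    (Ev.mul hp (computes_n hm) ?_) hu ?_) (computes_n hm) ?_) hv ?_) ?_)).congr
    (hm.adj p hpT u hun v hvn) <;> refine hF.lt_of_le ?_ <;> linarith

theorem computes_nonIsolated {tp tv : Tm} {p v : ℕ} (hp : D.Computes w mem env tp p)
    (hv : D.Computes w mem env tv v) (hpT : p < D.T) (hvn : v < D.n) :
    D.Computes w mem env (tNonIsolated tp tv) (truth (D.NonIsolated p v)) :=
  Ev.any hF.w_pos hF.rounds_lt (computes_n hm) (by omega) _ fun u hu =>
    computes_adj hF hm (hp.lift u) (Ev.var_zero u) (hv.lift u) hpT hu hvn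

theorem computes_spans {ta tb tv : Tm} {a b v : ℕ} (ha : D.Computes w mem env ta a)
    (hb : D.Computes w mem env tb b) (hv : D.Computes w mem env tv v) (haT : a ≤ D.T)
    (hvn : v < D.n) : D.Computes w mem env (tSpans ta tb tv) (truth (D.Spans a b v)) := by
  have h1 : D.Computes w mem env _ _ :=
    Ev.any (bound := ta) hF.w_pos hF.rounds_lt ha (by omega) (fun p => D.NonIsolated p v)
      fun p hp => computes_nonIsolated hF hm (Ev.var_zero p) (hv.lift p) (by omega) hvn
  -- The search over times from `b` on runs backwards: `q` below `T - b` stands for the time `T - 1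
  -- - q`.
  have h2 : D.Computes w mem env _ _ :=
    Ev.any hF.w_pos hF.rounds_lt (Ev.sub (computes_T hF hm) hb) (by omega)
      (fun q => D.NonIsolated (D.T - 1 - q) v)
      fun q hq => computes_nonIsolated hF hm (computes_rev hF hm (Ev.var_zero q)) (hv.lift q)
        (by omega) hvn
  refine (Ev.and h1 fun _ => h2).congr (truth_congr (and_congr_right fun _ => ⟨?_, ?_⟩))
  · rintro ⟨q, hq, h⟩
    exact ⟨_, h.lt, by omega, h⟩
  · rintro ⟨q, hq, hbq, h⟩
    exact ⟨D.T - 1 - q, by omega, by rwa [show D.T - 1 - (D.T - 1 - q) = q by omega]⟩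

theorem computes_weight {ta tb tv : Tm} {a b v i : ℕ} (ha : D.Computes w mem env ta a)
    (hb : D.Computes w mem env tb b) (hv : D.Computes w mem env tv v) (haT : a ≤ D.T)
    (hvn : v ≤ D.n) (hi : i < D.T) (hP : ∀ u, D.Spans a b u → D.InBag i u) :
    D.Computes w mem env (tWeight ta tb tv) (digitWeight (D.Spans a b) D.C v) := by
  classical
  have hlt : digitWeight (D.Spans a b) D.C v < 2 ^ w :=
    hF.lt_of_le (by linarith [digitWeight_le_numConfigs hP hvn, hF.size_le i hi, hF.le_pow_four])
  refine Ev.prod hF.w_pos hF.rounds_lt hv (by omega) _ (fun u => ?_) (fun u hu => ?_) hlt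
  · have := D.C_pos
    split_ifs <;> omega
  · exact (computes_spans hF hm (ha.lift u) (hb.lift u) (Ev.var_zero u) haT (by omega)).ite_truth
      (fun _ => computes_C hF hm) fun _ => Ev.one hF.w_pos

theorem computes_encode {ta tb tf : Tm} {a b i : ℕ} {f : ℕ → ℕ} (ha : D.Computes w mem env ta a)
    (hb : D.Computes w mem env tb b) (haT : a ≤ D.T) (hi : i < D.T)
    (hP : ∀ u, D.Spans a b u → D.InBag i u) (hf : ∀ v < D.n, D.Spans a b v → f v < D.C)
    (htf : ∀ v < D.n, D.Computes w mem (scons v env) tf (f v)) :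
    D.Computes w mem env (tEncode ta tb tf) (encodeDigits (D.Spans a b) D.C D.n f) := by
  classical
  have hlt : encodeDigits (D.Spans a b) D.C D.n f < 2 ^ w :=
    hF.lt_of_le (by linarith [encodeDigits_lt_numConfigs hP hf, hF.size_le i hi, hF.le_pow_four])
  refine Ev.sum hF.w_pos hF.rounds_lt (computes_n hm) (by omega) _ (fun v hv => ?_) hlt
  refine (computes_spans hF hm (ha.lift v) (hb.lift v) (Ev.var_zero v) haT hv).ite_truth
    (fun h => Ev.mul (htf v hv)
      (computes_weight hF hm (ha.lift v) (hb.lift v) (Ev.var_zero v) haT hv.le hi hP) ?_)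
    fun _ => Ev.zero
  -- A single summand is at most the whole code, which fits into a word.
  refine lt_of_le_of_lt ?_ hlt
  refine le_trans ?_ (Finset.single_le_sum (f := fun v => if D.Spans a b v then
    f v * digitWeight (D.Spans a b) D.C v else 0) (fun _ _ => Nat.zero_le _) (Finset.mem_range.2 hv))
  simp only [h, if_true, le_refl]

variable {ti tz tv : Tm} {i z v : ℕ} (hti : D.Computes w mem env ti i) (hi : i < D.T)
include hti hi

theorem computes_inBag (htv : D.Computes w mem env tv v) (hv : v < D.n) :
    D.Computes w mem env (tSpans (tSucc ti) ti tv) (truth (D.InBag i v)) :=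
  computes_spans hF hm (computes_succ hF hti hi.le) hti htv hi hv

theorem computes_numConfigs : D.Computes w mem env (tNumConfigs ti) (D.numConfigs i) :=
  computes_weight hF hm (computes_succ hF hti hi.le) hti (computes_n hm) hi le_rfl hi
    fun _ h => h

variable (htz : D.Computes w mem env tz z)
include htz

theorem computes_digit (htv : D.Computes w mem env tv v) (hv : v < D.n) :
    D.Computes w mem env (tDigit ti tz tv) (D.digit i z v) :=
  Ev.mod (Ev.div htz (computes_weight hF hm (computes_succ hF hti hi.le) hti htv hi hv.le hi
    fun _ h => h)) (computes_C hF hm)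

theorem computes_before (htv : D.Computes w mem env tv v) (hv : v < D.n) :
    D.Computes w mem env (tBefore ti tz tv) (D.before i z v) :=
  Ev.div (computes_digit hF hm hti hi htz htv hv) (computes_const hF (by norm_num))

theorem computes_act (htv : D.Computes w mem env tv v) (hv : v < D.n) :
    D.Computes w mem env (tAct ti tz tv) (truth (D.Act i z v)) := by
  refine (Ev.and (Ev.and (computes_inBag hF hm hti hi htv hv) fun _ =>
    Ev.truth_lt hF.w_pos Ev.zero (computes_before hF hm hti hi htz htv hv)) fun _ =>
    Ev.truth_eq hF.w_pos (Ev.mod (computes_digit hF hm hti hi htz htv hv)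
      (computes_const hF (by norm_num))) (Ev.one hF.w_pos)).congr (truth_congr ?_)
  rw [Act, Nat.pos_iff_ne_zero]

theorem computes_after (htv : D.Computes w mem env tv v) (hv : v < D.n) :
    D.Computes w mem env (tAfter ti tz tv) (D.after i z v) := by
  classical
  have hb := computes_before hF hm hti hi htz htv hv
  refine (computes_act hF hm hti hi htz htv hv).ite_truth
    (fun _ => Ev.sub hb (Ev.one hF.w_pos))
    fun _ => Ev.mul (Ev.div hb (computes_L hF hm)) (computes_L hF hm) (hF.lt_of_le ?_)
  have h1 := Nat.div_mul_le_self (D.before i z v) (D.ℓ + 1)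
  have h2 := D.before_le i z v
  linarith [hF.M_le, hF.sq_le]

theorem computes_source : D.Computes w mem env (tSource ti tz) (D.source i z) :=
  computes_encode hF hm hti hti hi.le hi (fun _ => carried_inBag)
    (fun _ _ _ => (D.before_le _ _ _).trans_lt D.M_lt_C)
    fun v hv => computes_before hF hm (hti.lift v) hi (htz.lift v) (Ev.var_zero v) hv

theorem computes_target : D.Computes w mem env (tTarget ti tz) (D.target i z) :=
  computes_encode hF hm (computes_succ hF hti hi.le) (computes_succ hF hti hi.le) hi hi
    (fun _ => carried_succ_inBag)
    (fun _ _ _ => ((D.after_le_before _ _ _).trans (D.before_le _ _ _)).trans_lt D.M_lt_C)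
    fun v hv => computes_after hF hm (hti.lift v) hi (htz.lift v) (Ev.var_zero v) hv

theorem computes_dom (htv : D.Computes w mem env tv v) (hv : v < D.n) :
    D.Computes w mem env (tDom ti tz tv) (truth (D.Dom i z v)) :=
  Ev.any hF.w_pos hF.rounds_lt (computes_n hm) (by omega) _ fun u hu =>
    Ev.and (computes_act hF hm (hti.lift u) hi (htz.lift u) (Ev.var_zero u) hu) fun _ =>
      Ev.or hF.w_pos (Ev.truth_eq hF.w_pos (Ev.var_zero u) (htv.lift u))
        (computes_adj hF hm (hti.lift u) (Ev.var_zero u) (htv.lift u) hi hu hv)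

theorem computes_vertexGain (htv : D.Computes w mem env tv v) (hv : v < D.n) :
    D.Computes w mem env (tVertexGain ti tz tv) (D.vertexGain i z v) := by
  classical
  have hs := computes_succ hF hti hi.le
  have h1 : ∀ {x y a b : ℕ}, x ≤ 1 → a ≤ i → b ≤ D.T - 1 - i → x + (a + b) < 2 ^ w := fun h h' h'' =>
    hF.lt_of_le (by have := hF.T_le; have := hF.le_pow_four; omega)
  have e1 := (computes_spans hF hm hti hti htv hi.le hv).ite_truth (fun _ => Ev.zero)
    fun _ => Ev.min hF.w_pos hti
      (Ev.sub (computes_M hF hm) (computes_before hF hm hti hi htz htv hv))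
  have e2 := (computes_spans hF hm hs hs htv hi hv).ite_truth (fun _ => Ev.zero)
    fun _ => Ev.min hF.w_pos (computes_rev hF hm hti) (computes_after hF hm hti hi htz htv hv)
  have e3 := computes_dom hF hm hti hi htz htv hv
  have b1 : (if D.Carried i v then 0 else min i (D.M - D.before i z v)) ≤ i := by
    split_ifs <;> omega
  have b2 : (if D.Carried (i + 1) v then 0 else min (D.T - 1 - i) (D.after i z v)) ≤
      D.T - 1 - i := by
    split_ifs <;> omega
  have := hF.T_le
  have := hF.le_pow_four
  have := hF.eight_le
  have b3 : (if D.Dom i z v then 1 else 0) ≤ 1 := by split_ifs <;> omega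
  exact (computes_inBag hF hm hti hi htv hv).ite_truth
    (fun _ => Ev.add e3 (Ev.add e1 e2 (hF.lt_of_le (by omega))) (hF.lt_of_le (by omega)))
    fun _ => Ev.zero

theorem computes_gain : D.Computes w mem env (tGain ti tz) (D.gain i z) := by
  refine Ev.sum hF.w_pos hF.rounds_lt (computes_n hm) (by omega) _ (fun v hv =>
    computes_vertexGain hF hm (hti.lift v) hi (htz.lift v) (Ev.var_zero v) hv) (hF.lt_of_le ?_)
  have h1 := gain_le hi z
  have h2 := hF.table_bound
  have h3 : D.n * (2 * D.T) ≤ D.T * (D.n * (2 * D.T)) := Nat.le_mul_of_pos_left _ (by omega)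
  exact h1.trans (by omega)

omit hti hi htz in
theorem computes_isolatedGain : D.Computes w mem env tIsolatedGain D.totalIsolatedGain := by
  classical
  refine Ev.sum hF.w_pos hF.rounds_lt (computes_n hm) (by omega) _ (fun v hv =>
    (computes_spans hF hm (computes_T hF hm) Ev.zero (Ev.var_zero v) le_rfl hv).ite_truth
      (fun _ => Ev.zero) fun _ => Ev.min hF.w_pos (computes_T hF hm) (computes_M hF hm))
    (hF.lt_of_le ?_)
  have h1 := D.totalIsolatedGain_le
  have h2 := hF.table_bound
  exact h1.trans (by omega)

end

end TimelineInstance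

namespace WordRAM

/-- Write the value of the term `e` into the memory cell whose address is the value of the term
`a`. -/
def storeTm (ρ : ℕ → ℕ) (d : ℕ) (a e : Tm) : Program :=
  .seq (a.compile ρ d) (.seq (e.compile ρ (d + 1)) (.store (.reg d) (.reg (d + 1))))

theorem exec_storeTm {w R : ℕ} {mem env : ℕ → ℕ} {a e : Tm} {x v : ℕ} (ha : Ev w R mem env a x)
    (he : Ev w R mem env e v) {ρ : ℕ → ℕ} {d : ℕ} {s : State} (hρ : ∀ i, ρ i < d)
    (hmem : s.mem = mem) (henv : ∀ i, s.reg (ρ i) = env i) :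
    ∃ s' m, Exec w (storeTm ρ d a e) s s' m ∧ m ≤ a.cost R + e.cost R + 3 ∧
      s'.mem = Function.update mem x v ∧ ∀ r < d, s'.reg r = s.reg r := by
  obtain ⟨s₁, m₁, h₁, hm₁, hmem₁, hr₁, hv₁⟩ := ha ρ d s hρ hmem henv
  obtain ⟨s₂, m₂, h₂, hm₂, hmem₂, hr₂, hv₂⟩ := he ρ (d + 1) s₁
    (fun i => (hρ i).trans d.lt_succ_self) hmem₁ (fun i => by rw [hr₁ _ (hρ i), henv i])
  refine ⟨_, _, h₁.seq (h₂.seq (Exec.store s₂ _ _)), ?_, ?_, fun r hr => ?_⟩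
  · simp only [Expr.cost]; omega
  · simp only [Expr.eval, hv₂, hr₂ d d.lt_succ_self, hv₁, hmem₂]
  · show s₂.reg r = s.reg r
    rw [hr₂ r (by omega), hr₁ r hr]

end WordRAM

/-! ## The program -/

namespace TimelineInstance

open WordRAM

/-! ### Layout and contents of the table in memory. -/

section Memory

variable (D : TimelineInstance)

/-- The memory cells from this one on are used for the table. -/
def base : ℕ := 5 + D.T * D.n * D.n

/-- The memory cell for the table entry with code `y` at time `i`. -/
def cell (i y : ℕ) : ℕ := D.base + (y * (D.T + 1) + i)

variable {D}

/-- The time is the last digit in base `T + 1`, so the addresses do not require the number of codes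
to be known in advance. -/
theorem cell_inj {i j x y : ℕ} (hi : i ≤ D.T) (hj : j ≤ D.T) (h : D.cell i x = D.cell j y) :
    i = j ∧ x = y := by
  have h' : i + (D.T + 1) * x = j + (D.T + 1) * y := by
    unfold cell at h; linarith
  have h1 := congrArg (· % (D.T + 1)) h'
  have h2 := congrArg (· / (D.T + 1)) h'
  simp only [Nat.add_mul_mod_self_left, Nat.mod_eq_of_lt (Nat.lt_succ_of_le hi),
    Nat.mod_eq_of_lt (Nat.lt_succ_of_le hj)] at h1
  simp only [Nat.add_mul_div_left _ _ D.T.succ_pos, Nat.div_eq_of_lt (Nat.lt_succ_of_le hi),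
    Nat.div_eq_of_lt (Nat.lt_succ_of_le hj), zero_add] at h2
  exact ⟨h1, h2⟩

/-- The memory consists of the input `mem₀` and a table with entries `f`. -/
def Holds (D : TimelineInstance) (mem₀ mem : ℕ → ℕ) (f : ℕ → ℕ → ℕ) : Prop :=
  (∀ a < D.base, mem a = mem₀ a) ∧ ∀ i ≤ D.T, ∀ y, mem (D.cell i y) = f i y

theorem Holds.update {mem₀ mem : ℕ → ℕ} {f g : ℕ → ℕ → ℕ} (h : D.Holds mem₀ mem f) {i y v : ℕ}
    (hi : i ≤ D.T) (hg : g i y = v) (hfg : ∀ j x, ¬ (j = i ∧ x = y) → g j x = f j x) :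
    D.Holds mem₀ (Function.update mem (D.cell i y) v) g := by
  refine ⟨fun a ha => ?_, fun j hj x => ?_⟩
  · rw [Function.update_of_ne (by unfold cell; omega), h.1 a ha]
  · by_cases hjx : j = i ∧ x = y
    · rw [hjx.1, hjx.2, Function.update_self, hg]
    · rw [Function.update_of_ne fun hc => hjx (cell_inj hj hi hc), h.2 j hj, hfg j x hjx]

/-- The table begins after the four header cells, the matrices and one further cell for `t`, so
writing to it leaves the instance intact. -/
theorem Encoded.of_holds {mem₀ mem : ℕ → ℕ} {f : ℕ → ℕ → ℕ} (hm : D.Encoded mem₀)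
    (h : D.Holds mem₀ mem f) : D.Encoded mem := by
  have h5 : 5 ≤ D.base := Nat.le_add_right _ _
  refine ⟨?_, ?_, ?_, ?_, fun p hp u hu v hv => ?_⟩
  · rw [h.1 _ (by omega), hm.n]
  · rw [h.1 _ (by omega), hm.T]
  · rw [h.1 _ (by omega), hm.k]
  · rw [h.1 _ (by omega), hm.ℓ]
  · rw [h.1, hm.adj p hp u hu v hv]
    have h1 : (p + 1) * D.n ≤ D.T * D.n := Nat.mul_le_mul_right _ hp
    have h2 : (p * D.n + u + 1) * D.n ≤ D.T * D.n * D.n := Nat.mul_le_mul_right _ (by linarith)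
    unfold base
    linarith

/-- The new value proposed by a configuration for the table entry at its target. -/
noncomputable def candidate (D : TimelineInstance) (i z : ℕ) : ℕ :=
  if D.table i (D.source i z) = 0 then 0 else D.table i (D.source i z) + D.gain i z

/-- The table entries at time `i + 1` after the configurations below `m` have been considered. -/
noncomputable def partialTable (D : TimelineInstance) (i m y : ℕ) : ℕ :=
  (Finset.range m).sup fun z => if D.target i z = y then D.candidate i z else 0

theorem table_succ (i y : ℕ) : D.table (i + 1) y = D.partialTable i (D.numConfigs i) y := rfl

theorem partialTable_succ (i m y : ℕ) : D.partialTable i (m + 1) y =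
    max (D.partialTable i m y) (if D.target i m = y then D.candidate i m else 0) := by
  rw [partialTable, Finset.range_add_one, Finset.sup_insert, max_comm]
  rfl

/-- The contents of the table after the times before `i` and the configurations below `m` at time
`i` have been considered. -/
noncomputable def stage (D : TimelineInstance) (i m j y : ℕ) : ℕ :=
  if j ≤ i then D.table j y else if j = i + 1 then D.partialTable i m y else 0

/-- After all configurations, row `i + 1` is complete; row `i + 2` is a supremum over the empty set,
which agrees with untouched memory being `0`. -/
theorem stage_numConfigs (i : ℕ) : D.stage i (D.numConfigs i) = D.stage (i + 1) 0 := by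
  funext j y
  unfold stage
  rcases lt_trichotomy j (i + 1) with h | rfl | h
  · rw [if_pos (by omega), if_pos (by omega)]
  · rw [if_neg (by omega), if_pos rfl, if_pos le_rfl, table_succ]
  · rw [if_neg (by omega), if_neg (by omega), if_neg (by omega)]
    split_ifs <;> rfl

end Memory

/-- The term for `cell`. -/
def tCell (i y : Tm) : Tm :=
  .bin .add (.bin .add (.const 5) (.bin .mul (.bin .mul tT tN) tN))
    (.bin .add (.bin .mul y (tSucc tT)) i)

/-- The term for the new value of a table entry. -/
def tNewValue : Tm :=
  (Tm.load (tCell (tSucc (.var 1)) (tTarget (.var 1) (.var 0)))).max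
    (.ite (.load (tCell (.var 1) (tSource (.var 1) (.var 0))))
      (.bin .add (.load (tCell (.var 1) (tSource (.var 1) (.var 0)))) (tGain (.var 1) (.var 0)))
      (.const 0))

/-- The assignment of registers to variables: the time is in register `1` and the configuration in
register `2`. -/
def registers : ℕ → ℕ := scons 2 (scons 1 fun _ => 0)

/-- The treatment of one configuration. -/
def configStep : Program :=
  .seq (storeTm registers 5 (tCell (tSucc (.var 1)) (tTarget (.var 1) (.var 0))) tNewValue)
    (.assign 2 (.bin .add (.reg 2) (.const 1)))

/-- The treatment of one time step. -/
def timeStep : Program :=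
  .seq ((tNumConfigs (.var 1)).compile registers 4) (.seq (.assign 2 (.const 0))
    (.seq (.loop (.bin .lt (.reg 2) (.reg 4)) configStep)
      (.assign 1 (.bin .add (.reg 1) (.const 1)))))

/-- The program that decides whether more than `threshold - 1` temporal vertices can be
dominated. -/
def program (threshold : Tm) : Program :=
  .seq (storeTm registers 5 (tCell (.const 0) (.const 0)) (.bin .add (.const 1) tIsolatedGain))
    (.seq (tT.compile registers 3) (.seq (.assign 1 (.const 0))
      (.seq (.loop (.bin .lt (.reg 1) (.reg 3)) timeStep)
        (.seq ((Tm.bin .lt threshold (.load (tCell tT (.const 0)))).compile registers 5)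
          (.assign 0 (.reg 5))))))

/-- The running time of `configStep`. -/
def configStepCost (R : ℕ) : ℕ :=
  (tCell (tSucc (.var 1)) (tTarget (.var 1) (.var 0))).cost R + tNewValue.cost R + 7

/-- The running time of `timeStep` per configuration. -/
def timeStepCost (R : ℕ) : ℕ := (tNumConfigs (.var 1)).cost R + configStepCost R + 14

/-- The running time of `program` per configuration. -/
def programCost (threshold : Tm) (R : ℕ) : ℕ :=
  (tCell (.const 0) (.const 0)).cost R + (Tm.bin .add (.const 1) tIsolatedGain).cost R +
    tT.cost R + R * (timeStepCost R + 4) +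
    (Tm.bin .lt threshold (.load (tCell tT (.const 0)))).cost R + 11

theorem programCost_le (threshold : Tm) : ∃ c, ∀ R, 1 ≤ R → programCost threshold R ≤ c * R ^ c := by
  obtain ⟨c₁, h₁⟩ := (tCell (.const 0) (.const 0)).cost_le
  obtain ⟨c₂, h₂⟩ := (Tm.bin .add (.const 1) tIsolatedGain).cost_le
  obtain ⟨c₃, h₃⟩ := tT.cost_le
  obtain ⟨c₄, h₄⟩ := (tNumConfigs (.var 1)).cost_le
  obtain ⟨c₅, h₅⟩ := (tCell (tSucc (.var 1)) (tTarget (.var 1) (.var 0))).cost_le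
  obtain ⟨c₆, h₆⟩ := tNewValue.cost_le
  obtain ⟨c₇, h₇⟩ := (Tm.bin .lt threshold (.load (tCell tT (.const 0)))).cost_le
  exact ⟨_, fun R hR => polyBound_add hR (polyBound_add hR (polyBound_add hR (polyBound_add hR
    (polyBound_add hR (h₁ R hR) (h₂ R hR)) (h₃ R hR)) (polyBound_mul (polyBound_add hR
      (polyBound_add hR (polyBound_add hR (h₄ R hR) (polyBound_add hR
        (polyBound_add hR (h₅ R hR) (h₆ R hR)) (polyBound_const hR))) (polyBound_const hR))
      (polyBound_const hR)))) (h₇ R hR)) (polyBound_const hR)⟩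

/-! ### Correctness and running time of the program. -/

section Correctness

variable {D : TimelineInstance} {w Q : ℕ}

theorem registers_lt {d : ℕ} (hd : 2 < d) (i : ℕ) : registers i < d := by
  rcases i with _ | _ | i
  · exact hd
  · show 1 < d; omega
  · show 0 < d; omega

theorem registers_env {s : State} {i z : ℕ} (h0 : s.reg 0 = 0) (h1 : s.reg 1 = i)
    (h2 : s.reg 2 = z) (r : ℕ) : s.reg (registers r) = scons z (scons i fun _ => 0) r := by
  rcases r with _ | _ | r
  · exact h2
  · exact h1
  · exact h0

theorem computes_cell (hF : D.Fits w Q) {mem env : ℕ → ℕ} (hm : D.Encoded mem) {ti ty : Tm}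
    {i y : ℕ} (hti : D.Computes w mem env ti i) (hty : D.Computes w mem env ty y) (hi : i ≤ D.T)
    (hy : y ≤ Q) : D.Computes w mem env (tCell ti ty) (D.cell i y) := by
  have h1 : D.T * D.n ≤ Q ^ 2 := (Nat.mul_le_mul hF.T_le hF.n_le).trans (by rw [sq])
  have h2 : D.T * D.n * D.n ≤ Q ^ 3 := (Nat.mul_le_mul h1 hF.n_le).trans_eq (by ring)
  have h3 : y * (D.T + 1) ≤ Q ^ 2 + Q :=
    (Nat.mul_le_mul hy (Nat.add_le_add_right hF.T_le 1)).trans_eq (by ring)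
  have h4 := hF.pow_le_pow (show 3 ≤ 4 by norm_num)
  have h5 := hF.pow_le_pow (show 2 ≤ 4 by norm_num)
  have h6 := hF.le_pow_four
  have h7 := hF.T_le
  have h8 := hF.eight_le
  have h9 := hF.sq_le
  have hn := computes_n (w := w) (env := env) hm
  have hT := computes_T (env := env) hF hm
  show Ev _ _ _ _ _ (5 + D.T * D.n * D.n + (y * (D.T + 1) + i))
  refine Ev.add (Ev.add (computes_const hF (by norm_num)) (Ev.mul (Ev.mul hT hn ?_) hn ?_) ?_)
    (Ev.add (Ev.mul hty (computes_succ hF hT le_rfl) ?_) hti ?_) ?_ <;>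
    refine hF.lt_of_le ?_ <;> omega

theorem candidate_lt {i : ℕ} (hi : i < D.T) (z : ℕ) :
    D.table i (D.source i z) + D.gain i z ≤ 1 + D.n * D.T + D.T * (D.n * (2 * D.T)) := by
  have h1 := table_le (D := D) i hi.le (D.source i z)
  have h2 := gain_le hi z
  have h3 : (i + 1) * (D.n * (2 * D.T)) ≤ D.T * (D.n * (2 * D.T)) := Nat.mul_le_mul_right _ hi
  rw [Nat.succ_mul] at h3
  omega

/-- Configuration `z` can change only the entry of its target in row `i + 1`; it reads row `i`,
which is already final. -/
theorem exec_configStep (hF : D.Fits w Q) {mem₀ : ℕ → ℕ} (hm : D.Encoded mem₀) {i z : ℕ}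
    (hi : i < D.T) {s : State} (h0 : s.reg 0 = 0) (h1 : s.reg 1 = i)
    (h2 : s.reg 2 = z) (hzlt : z + 1 < 2 ^ w) (hs : D.Holds mem₀ s.mem (D.stage i z)) :
    ∃ s' m, Exec w configStep s s' m ∧ m ≤ configStepCost (D.n + D.T) ∧
      D.Holds mem₀ s'.mem (D.stage i (z + 1)) ∧ s'.reg 2 = z + 1 ∧
      ∀ r < 5, r ≠ 2 → s'.reg r = s.reg r := by
  have hm' := hm.of_holds hs
  set env := scons z (scons i fun _ => 0) with henv
  have hti : D.Computes w s.mem env (.var 1) i := Ev.var 1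
  have htz : D.Computes w s.mem env (.var 0) z := Ev.var 0
  have hsz := hF.size_le i hi
  have htgt := computes_target hF hm' hti hi htz
  have hsrc := computes_source hF hm' hti hi htz
  have hc1 := computes_cell hF hm' (computes_succ hF hti hi.le) htgt hi
    ((target_lt i z).le.trans hsz)
  have hc2 := computes_cell hF hm' hti hsrc hi.le ((source_lt i z).le.trans hsz)
  have hl1 : D.Computes w s.mem env _ (D.partialTable i z (D.target i z)) :=
    (Ev.load hc1).congr (by rw [hs.2 _ hi, stage, if_neg (by omega), if_pos rfl])
  have hl2 : D.Computes w s.mem env _ (D.table i (D.source i z)) :=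
    (Ev.load hc2).congr (by rw [hs.2 _ hi.le, stage, if_pos le_rfl])
  have hcand : D.Computes w s.mem env _ (D.candidate i z) :=
    Ev.ite hl2 (fun h => (Ev.add hl2 (computes_gain hF hm' hti hi htz) (hF.lt_of_le (by
        have := candidate_lt hi z
        have := hF.table_bound
        omega))).congr (if_neg h).symm)
      fun h => Ev.zero.congr (if_pos h).symm
  obtain ⟨s₁, m₁, e₁, hm₁, hmem₁, hr₁⟩ := exec_storeTm hc1
    (Ev.max hF.w_pos hl1 hcand) (registers_lt (d := 5) (by norm_num)) rfl
    (registers_env h0 h1 h2)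
  refine ⟨s₁.set 2 (z + 1), _, e₁.seq (Exec.assign' ?_), ?_, ?_, by simp, fun r hr hr2 => ?_⟩
  · have := Nat.one_lt_two_pow hF.w_pos.ne'
    simp only [Expr.eval, Op.apply]
    rw [hr₁ 2 (by norm_num), h2, Nat.mod_eq_of_lt this, Nat.mod_eq_of_lt hzlt]
  · simp only [Expr.cost, configStepCost, tNewValue] at hm₁ ⊢
    omega
  · rw [State.set_mem, hmem₁]
    refine hs.update hi ?_ fun j x hjx => ?_
    · rw [stage, if_neg (by omega), if_pos rfl, partialTable_succ, if_pos rfl]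
    · unfold stage
      split_ifs with h h'
      · rfl
      · rw [partialTable_succ, if_neg fun h'' => hjx ⟨h', h''.symm⟩, Nat.max_zero]
      · rfl
  · rw [State.set_reg_ne _ _ hr2, hr₁ r hr]

/-- Two size bounds are kept apart: `Q` serves only to exclude overflow, while `S` bounds the number
of configurations in the running time, which must be linear in it. -/
theorem exec_timeStep (hF : D.Fits w Q) {mem₀ : ℕ → ℕ} (hm : D.Encoded mem₀) {S i : ℕ}
    (hS : 1 ≤ S) (hsize : ∀ i < D.T, D.numConfigs i ≤ S)
    (hi : i < D.T) {s : State} (h0 : s.reg 0 = 0) (h1 : s.reg 1 = i) (h3 : s.reg 3 = D.T)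
    (hs : D.Holds mem₀ s.mem (D.stage i 0)) :
    ∃ s' m, Exec w timeStep s s' m ∧ m ≤ S * timeStepCost (D.n + D.T) ∧
      ((s'.reg 1 = i + 1 ∧ s'.reg 3 = D.T) ∧ s'.reg 0 = 0 ∧
        D.Holds mem₀ s'.mem (D.stage (i + 1) 0)) := by
  have hone := Nat.one_lt_two_pow hF.w_pos.ne'
  have hsz := hF.size_le i hi
  have hb : ∀ z, z ≤ Q → z + 1 < 2 ^ w := fun z hz =>
    hF.lt_of_le (by have := hF.le_pow_four; have := hF.eight_le; omega)
  obtain ⟨s₁, m₁, e₁, hm₁, hmem₁, hr₁, hv₁⟩ := computes_numConfigs hF (hm.of_holds hs)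
    (env := scons (s.reg 2) (scons i fun _ => 0)) (Ev.var 1) hi registers 4 s
    (registers_lt (by norm_num)) rfl (registers_env h0 h1 rfl)
  obtain ⟨s₂, m₂, e₂, hm₂, ⟨-, -⟩, h0₂, h1₂, h3₂, hs₂⟩ := exec_count (w := w) (j := 2) (b := 4)
    (P := configStep) (n := D.numConfigs i) (c := configStepCost (D.n + D.T)) hF.w_pos
    (fun z t => (t.reg 2 = z ∧ t.reg 4 = D.numConfigs i) ∧ t.reg 0 = 0 ∧ t.reg 1 = i ∧
      t.reg 3 = D.T ∧ D.Holds mem₀ t.mem (D.stage i z)) (fun z t h => h.1)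
    (fun z hz t ⟨⟨ht2, ht4⟩, ht0, ht1, ht3, hst⟩ => by
      obtain ⟨t', m, e, hm', hst', h2', hr'⟩ :=
        exec_configStep hF hm hi ht0 ht1 ht2 (hb z (hz.le.trans hsz)) hst
      exact ⟨t', m, e, hm', ⟨h2', by rw [hr' 4 (by norm_num) (by norm_num), ht4]⟩,
        by rw [hr' 0 (by norm_num) (by norm_num), ht0],
        by rw [hr' 1 (by norm_num) (by norm_num), ht1],
        by rw [hr' 3 (by norm_num) (by norm_num), ht3], hst'⟩)
    (s := s₁.set 2 0)
    ⟨⟨by simp, by rw [State.set_reg_ne _ _ (by norm_num)]; exact hv₁⟩,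
      by rw [State.set_reg_ne _ _ (by norm_num), hr₁ 0 (by norm_num), h0],
      by rw [State.set_reg_ne _ _ (by norm_num), hr₁ 1 (by norm_num), h1],
      by rw [State.set_reg_ne _ _ (by norm_num), hr₁ 3 (by norm_num), h3],
      by rw [State.set_mem, hmem₁]; exact hs⟩
  refine ⟨s₂.set 1 (i + 1), _, e₁.seq ((Exec.assign' ?_).seq (e₂.seq (Exec.assign' ?_))), ?_,
    ⟨by simp, by rw [State.set_reg_ne _ _ (by norm_num), h3₂]⟩,
    by rw [State.set_reg_ne _ _ (by norm_num), h0₂], ?_⟩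
  · simp [Expr.eval]
  · simp only [Expr.eval, Op.apply]
    rw [h1₂, Nat.mod_eq_of_lt hone, Nat.mod_eq_of_lt (hb i (hi.le.trans hF.T_le))]
  · have h4 : D.numConfigs i * (configStepCost (D.n + D.T) + 4) ≤
        S * (configStepCost (D.n + D.T) + 4) := Nat.mul_le_mul_right _ (hsize i hi)
    have h5 : (tNumConfigs (.var 1)).cost (D.n + D.T) + 10 ≤
        S * ((tNumConfigs (.var 1)).cost (D.n + D.T) + 10) := Nat.le_mul_of_pos_left _ hS
    have h6 : S * timeStepCost (D.n + D.T) = S * (configStepCost (D.n + D.T) + 4) +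
        S * ((tNumConfigs (.var 1)).cost (D.n + D.T) + 10) := by
      unfold timeStepCost; ring
    simp only [Expr.cost]
    omega
  · rw [State.set_mem, ← stage_numConfigs]; exact hs₂

/-- Zeroed memory beyond the input already represents an empty table, so no initialization of all
entries is needed. The threshold is evaluated at the end, when the memory below the table is still
that of the input. -/
theorem exec_program (hF : D.Fits w Q) {s : State} (hm : D.Encoded s.mem)
    (hzero : ∀ a, D.base ≤ a → s.mem a = 0) (hreg : ∀ r, s.reg r = 0) {S t : ℕ} (hS : 1 ≤ S)
    (hsize : ∀ i < D.T, D.numConfigs i ≤ S) {threshold : Tm}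
    (ht : ∀ mem env, D.Encoded mem → (∀ a < D.base, mem a = s.mem a) →
      D.Computes w mem env threshold t) :
    ∃ s' m, Exec w (program threshold) s s' m ∧ m ≤ S * programCost threshold (D.n + D.T) ∧
      s'.reg 0 = truth (t < D.table D.T 0) := by
  have hbound := hF.table_bound
  have hs : D.Holds s.mem s.mem fun _ _ => 0 :=
    ⟨fun _ _ => rfl, fun i _ y => hzero _ (Nat.le_add_right _ _)⟩
  obtain ⟨s₁, m₁, e₁, hm₁, hmem₁, hr₁⟩ := exec_storeTm (R := D.n + D.T) (s := s)
    (env := scons 0 (scons 0 fun _ => 0)) (computes_cell hF hm Ev.zero Ev.zero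
      (Nat.zero_le _) (Nat.zero_le _))
    (Ev.add (Ev.one hF.w_pos) (computes_isolatedGain hF hm) (hF.lt_of_le (by
      have := D.totalIsolatedGain_le
      omega))) (registers_lt (d := 5) (by norm_num)) rfl
    (registers_env (hreg 0) (hreg 1) (hreg 2))
  have hs₁ : D.Holds s.mem s₁.mem (D.stage 0 0) := by
    rw [hmem₁]
    refine hs.update (Nat.zero_le _) ?_ fun j x hjx => ?_
    · simp [stage, table]
    · unfold stage
      split_ifs with h h'
      · obtain rfl : j = 0 := by omega
        rw [table, if_neg fun hx => hjx ⟨rfl, hx⟩]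
      · rfl
      · rfl
  obtain ⟨s₂, m₂, e₂, hm₂, hmem₂, hr₂, hv₂⟩ := computes_T hF (hm.of_holds hs₁)
    (env := scons 0 (scons 0 fun _ => 0)) registers 3 s₁
    (registers_lt (by norm_num)) rfl (registers_env (by rw [hr₁ 0 (by norm_num), hreg])
      (by rw [hr₁ 1 (by norm_num), hreg]) (by rw [hr₁ 2 (by norm_num), hreg]))
  obtain ⟨s₃, m₃, e₃, hm₃, ⟨h1₃, -⟩, h0₃, hs₃⟩ := exec_count (w := w) (j := 1) (b := 3)
    (P := timeStep) (n := D.T) (c := S * timeStepCost (D.n + D.T)) hF.w_pos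
    (fun i t => (t.reg 1 = i ∧ t.reg 3 = D.T) ∧ t.reg 0 = 0 ∧ D.Holds s.mem t.mem (D.stage i 0))
    (fun z t h => h.1)
    (fun i hi t ⟨⟨h1, h3⟩, h0, h⟩ => exec_timeStep hF hm hS hsize hi h0 h1 h3 h)
    (s := s₂.set 1 0)
    ⟨⟨by simp, by rw [State.set_reg_ne _ _ (by norm_num), hv₂]⟩,
      by rw [State.set_reg_ne _ _ (by norm_num), hr₂ 0 (by norm_num), hr₁ 0 (by norm_num), hreg],
      by rw [State.set_mem, hmem₂]; exact hs₁⟩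
  have hm₃' := hm.of_holds hs₃
  have hfin : D.Computes w s₃.mem (scons (s₃.reg 2) (scons D.T fun _ => 0))
      (.bin .lt threshold (.load (tCell tT (.const 0)))) (truth (t < D.table D.T 0)) :=
    Ev.truth_lt hF.w_pos (ht _ _ hm₃' hs₃.1) ((Ev.load (computes_cell hF hm₃'
      (computes_T hF hm₃') Ev.zero le_rfl (Nat.zero_le _))).congr
        (by rw [hs₃.2 _ le_rfl, stage, if_pos le_rfl]))
  obtain ⟨s₄, m₄, e₄, hm₄, hmem₄, hr₄, hv₄⟩ := hfin registers 5 s₃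
    (registers_lt (by norm_num)) rfl (registers_env h0₃ h1₃ rfl)
  refine ⟨s₄.set 0 (truth (t < D.table D.T 0)), _, e₁.seq (e₂.seq ((Exec.assign' ?_).seq
    (e₃.seq (e₄.seq (Exec.assign' ?_))))), ?_, by simp⟩
  · simp [Expr.eval]
  · simp [Expr.eval, hv₄]
  · have h5 : D.T * (S * timeStepCost (D.n + D.T) + 4) ≤
        S * ((D.n + D.T) * (timeStepCost (D.n + D.T) + 4)) := by
      calc D.T * (S * timeStepCost (D.n + D.T) + 4)
          ≤ (D.n + D.T) * (S * timeStepCost (D.n + D.T) + S * 4) :=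
            Nat.mul_le_mul (Nat.le_add_left _ _) (by omega)
        _ = _ := by ring
    have h6 := Nat.le_mul_of_pos_left ((tCell (.const 0) (.const 0)).cost (D.n + D.T) +
      (Tm.bin .add (.const 1) tIsolatedGain).cost (D.n + D.T) + tT.cost (D.n + D.T) +
      (Tm.bin .lt threshold (.load (tCell tT (.const 0)))).cost (D.n + D.T) + 11) hS
    have h7 : S * programCost threshold (D.n + D.T) =
        S * ((tCell (.const 0) (.const 0)).cost (D.n + D.T) +
          (Tm.bin .add (.const 1) tIsolatedGain).cost (D.n + D.T) + tT.cost (D.n + D.T) +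
          (Tm.bin .lt threshold (.load (tCell tT (.const 0)))).cost (D.n + D.T) + 11) +
        S * ((D.n + D.T) * (timeStepCost (D.n + D.T) + 4)) := by
      unfold programCost; ring
    simp only [Expr.cost]
    omega

end Correctness

end TimelineInstance

/-! ## The main theorem -/

namespace TemporalGraph

open WordRAM

section

variable {n T : ℕ} (𝒢 : TemporalGraph (Fin n) T) (k ℓ : ℕ)

theorem length_adjacencyList : (adjacencyList 𝒢).length = T * n * n := by
  simp [adjacencyList]

theorem adjacencyList_getD (p : ℕ) (hp : p < T) (u : ℕ) (hu : u < n) (v : ℕ) (hv : v < n)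
    (rest : List ℕ) : (adjacencyList 𝒢 ++ rest).getD ((p * n + u) * n + v) 0 =
      truth ((𝒢.toInstance k ℓ).adj p u v) := by
  classical
  have h1 : p * n + u < T * n := by nlinarith [Nat.mul_le_mul_right n (Nat.succ_le_of_lt hp)]
  have h2 : (p * n + u) * n + v < T * n * n := by
    nlinarith [Nat.mul_le_mul_right n (Nat.succ_le_of_lt h1)]
  have hd : ∀ a b : ℕ, b < n → (a * n + b) / n = a := fun a b hb => by
    rw [mul_comm, Nat.mul_add_div (by omega), Nat.div_eq_of_lt hb, add_zero]
  have hm : ∀ a b : ℕ, b < n → (a * n + b) % n = b := fun a b hb => by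
    rw [mul_comm, Nat.mul_add_mod, Nat.mod_eq_of_lt hb]
  rw [List.getD_append _ _ _ _ (by rwa [length_adjacencyList]),
    List.getD_eq_getElem _ _ (by rwa [length_adjacencyList])]
  simp only [adjacencyList, List.getElem_ofFn]
  rw [truth_congr (toInstance_adj 𝒢 k ℓ ⟨p, hp⟩ ⟨u, hu⟩ ⟨v, hv⟩), truth]
  have e1 : Fin.divNat (Fin.divNat (⟨(p * n + u) * n + v, h2⟩ : Fin (T * n * n))) = ⟨p, hp⟩ :=
    Fin.ext (by simp [hd _ v hv, hd _ u hu])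
  have e2 : Fin.modNat (Fin.divNat (⟨(p * n + u) * n + v, h2⟩ : Fin (T * n * n))) = ⟨u, hu⟩ :=
    Fin.ext (by simp [hd _ v hv, hm _ u hu])
  have e3 : Fin.modNat (⟨(p * n + u) * n + v, h2⟩ : Fin (T * n * n)) = ⟨v, hv⟩ :=
    Fin.ext (by simp [hm _ v hv])
  rw [e1, e2, e3]

theorem encoded_initState {w : ℕ} (hw : 0 < w) (hn : n < 2 ^ w) (hT : T < 2 ^ w) (hk : k < 2 ^ w)
    (hℓ : ℓ < 2 ^ w) (rest : List ℕ) : (𝒢.toInstance k ℓ).Encoded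
      (initState w (n :: T :: k :: ℓ :: (adjacencyList 𝒢 ++ rest))).mem := by
  refine ⟨Nat.mod_eq_of_lt hn, Nat.mod_eq_of_lt hT, Nat.mod_eq_of_lt hk, Nat.mod_eq_of_lt hℓ,
    fun p hp u hu v hv => ?_⟩
  have h := adjacencyList_getD 𝒢 k ℓ p hp u hu v hv rest
  rw [add_comm]
  show (adjacencyList 𝒢 ++ rest).getD ((p * n + u) * n + v) 0 % 2 ^ w = _
  rw [h, Nat.mod_eq_of_lt ((truth_le _).trans_lt (Nat.one_lt_two_pow hw.ne'))]

/-- With `Q = N ^ 2`, the requirement `8 ≤ Q` follows from `3 ≤ N`, and `Q ^ 5 = N ^ 10` explains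
the condition `10 ≤ c`. -/
theorem fits_of_pow_le {w N c : ℕ} (hN : 3 ≤ N) (hc : 10 ≤ c) (h : N ^ c ≤ 2 ^ w) (hn : n ≤ N)
    (hT : T ≤ N) (hk : k ≤ N) (hℓ : ℓ ≤ N)
    (hsize : ((k + 1) * (ℓ + 2)) ^ (2 * vimw 𝒢) ≤ N) :
    (𝒢.toInstance k ℓ).Fits w (N ^ 2) := by
  have hQ : N ≤ N ^ 2 := Nat.le_self_pow two_ne_zero N
  refine ⟨by nlinarith, ?_, hn.trans hQ, hT.trans hQ, hk.trans hQ, hℓ.trans hQ,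
    fun i hi => ((numConfigs_le 𝒢 k ℓ i hi).trans hsize).trans hQ⟩
  rw [← pow_mul]
  exact (Nat.pow_le_pow_right (by omega) hc).trans h

/-- The program decides whether `t` temporal vertices can be dominated, if the term `threshold`
computes `t`. -/
theorem decidesWithin_program {w N c t : ℕ} (hT : 1 ≤ T) (hN : 3 ≤ N) (hc : 10 ≤ c)
    (h : N ^ c ≤ 2 ^ w) (hnN : n ≤ N) (hTN : T ≤ N) (hkN : k ≤ N) (hℓN : ℓ ≤ N)
    (hsize : ((k + 1) * (ℓ + 2)) ^ (2 * vimw 𝒢) ≤ N) {rest : List ℕ} (hrest : rest.length ≤ 1)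
    {threshold : Tm}
    (ht : ∀ mem env, (𝒢.toInstance k ℓ).Encoded mem →
      mem (4 + T * n * n) = rest.getD 0 0 % 2 ^ w →
      (𝒢.toInstance k ℓ).Computes w mem env threshold t)
    (hcost : TimelineInstance.programCost threshold (n + T) ≤ c * (n + T) ^ c) :
    DecidesWithin w (TimelineInstance.program threshold)
      (n :: T :: k :: ℓ :: (adjacencyList 𝒢 ++ rest))
      (c * ((k + 1) * (ℓ + 2)) ^ (2 * vimw 𝒢) * (n + T) ^ c) (TimelinePDS 𝒢 k ℓ t) := by
  have hF := fits_of_pow_le 𝒢 k ℓ hN hc h hnN hTN hkN hℓN hsize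
  have hNQ : N ≤ 6 * (N ^ 2) ^ 4 :=
    (Nat.le_self_pow two_ne_zero N).trans (hF.le_pow_four.trans (Nat.le_mul_of_pos_left _ (by omega)))
  have hm := encoded_initState 𝒢 k ℓ hF.w_pos (hF.lt_of_le (hnN.trans hNQ))
    (hF.lt_of_le (hTN.trans hNQ)) (hF.lt_of_le (hkN.trans hNQ)) (hF.lt_of_le (hℓN.trans hNQ)) rest
  have hcell : ∀ j, (initState w (n :: T :: k :: ℓ :: (adjacencyList 𝒢 ++ rest))).mem
      (4 + T * n * n + j) = rest.getD j 0 % 2 ^ w := fun j => by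
    rw [show 4 + T * n * n + j = T * n * n + j + 4 by ring]
    show (adjacencyList 𝒢 ++ rest).getD (T * n * n + j) 0 % 2 ^ w = _
    rw [List.getD_append_right _ _ _ _ (by rw [length_adjacencyList]; omega),
      length_adjacencyList, Nat.add_sub_cancel_left]
  have hbase : (𝒢.toInstance k ℓ).base = 5 + T * n * n := rfl
  obtain ⟨s, m, e, hme, hs⟩ := TimelineInstance.exec_program hF hm
    (S := ((k + 1) * (ℓ + 2)) ^ (2 * vimw 𝒢)) (t := t) (threshold := threshold)
    (fun a ha => by
      obtain ⟨j, rfl⟩ := Nat.exists_eq_add_of_le ha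
      rw [hbase, show 5 + T * n * n + j = 4 + T * n * n + (j + 1) by ring, hcell,
        List.getD_eq_default _ _ (show rest.length ≤ j + 1 by omega), Nat.zero_mod])
    (fun _ => rfl) (Nat.pow_pos (by positivity)) (numConfigs_le 𝒢 k ℓ)
    (fun mem env hmem hlt => ht mem env hmem (by rw [hlt (4 + T * n * n) (by omega)]; exact hcell 0))
  refine ⟨s, m, e, hme.trans ?_, ?_⟩
  · calc _ ≤ ((k + 1) * (ℓ + 2)) ^ (2 * vimw 𝒢) * (c * (n + T) ^ c) := Nat.mul_le_mul_left _ hcost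
      _ = _ := by ring
  · rw [hs, timelinePDS_iff_lt_table 𝒢 k ℓ hT]
    constructor
    · intro h1; exact truth_ne_zero.1 (h1 ▸ one_ne_zero)
    · exact truth_of

end

end TemporalGraph

/-- Timeline Partial Dominating Set, and also Timeline Dominating Set, can be solved in
`((k + 1) (ℓ + 2)) ^ (2 vimw) * (n + T) ^ O(1)` steps by a word RAM program. The word length `w` may
be any number that is at least a constant times the logarithm of the numbers in the input and of
`((k + 1) (ℓ + 2)) ^ (2 vimw)`; the program does not depend on it. -/
theorem mainTheorem2 :
    (∃ (P : WordRAM.Program) (c : ℕ),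
      ∀ (n T : ℕ) (𝒢 : TemporalGraph (Fin n) T) (k ℓ t : ℕ), 1 ≤ T → 1 ≤ k →
      ∀ w : ℕ,
        (n + T + k + ℓ + t + ((k + 1) * (ℓ + 2)) ^ (2 * TemporalGraph.vimw 𝒢)) ^ c ≤ 2 ^ w →
        WordRAM.DecidesWithin w P (TemporalGraph.encodePDS 𝒢 k ℓ t)
          (c * ((k + 1) * (ℓ + 2)) ^ (2 * TemporalGraph.vimw 𝒢) * (n + T) ^ c)
          (TemporalGraph.TimelinePDS 𝒢 k ℓ t)) ∧
    (∃ (P : WordRAM.Program) (c : ℕ),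
      ∀ (n T : ℕ) (𝒢 : TemporalGraph (Fin n) T) (k ℓ : ℕ), 1 ≤ T → 1 ≤ k →
      ∀ w : ℕ,
        (n + T + k + ℓ + ((k + 1) * (ℓ + 2)) ^ (2 * TemporalGraph.vimw 𝒢)) ^ c ≤ 2 ^ w →
        WordRAM.DecidesWithin w P (TemporalGraph.encodeDS 𝒢 k ℓ)
          (c * ((k + 1) * (ℓ + 2)) ^ (2 * TemporalGraph.vimw 𝒢) * (n + T) ^ c)
          (TemporalGraph.TimelineDS 𝒢 k ℓ)) := by
  open WordRAM TimelineInstance in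
  constructor
  · obtain ⟨c, hc⟩ := programCost_le
      (.load (.bin .add (.const 4) (.bin .mul (.bin .mul tT tN) tN)))
    -- The threshold `t` is read from the cell just after the adjacency matrices. Adding `10` to the
    -- constant of the time bound also secures the word length.
    refine ⟨program (.load (.bin .add (.const 4) (.bin .mul (.bin .mul tT tN) tN))), c + 10,
      fun n T 𝒢 k ℓ t hT hk w hw => ?_⟩
    have hS : 1 ≤ ((k + 1) * (ℓ + 2)) ^ (2 * TemporalGraph.vimw 𝒢) := Nat.pow_pos (by positivity)
    obtain ⟨Q, hF, ht⟩ : ∃ Q, (𝒢.toInstance k ℓ).Fits w Q ∧ t ≤ Q :=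
      ⟨_, TemporalGraph.fits_of_pow_le 𝒢 k ℓ (by omega) (by omega) hw (by omega) (by omega)
        (by omega) (by omega) (by omega), le_trans (by omega) (Nat.le_self_pow two_ne_zero _)⟩
    have h1 : T * n ≤ Q ^ 2 := (Nat.mul_le_mul hF.T_le hF.n_le).trans_eq (by ring)
    have h2 : T * n * n ≤ Q ^ 3 := (Nat.mul_le_mul h1 hF.n_le).trans_eq (by ring)
    have h3 : t < 2 ^ w := hF.lt_of_le (by linarith [hF.le_pow_four])
    exact TemporalGraph.decidesWithin_program 𝒢 k ℓ (rest := [t]) hT (by omega) (by omega) hw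
      (by omega) (by omega) (by omega) (by omega) (by omega) le_rfl
      (fun mem env hm hmt => by
        have h5 := hF.pow_le_pow (show 3 ≤ 4 by norm_num)
        have h6 := hF.pow_le_pow (show 2 ≤ 4 by norm_num)
        have h7 := hF.le_pow_four
        have h8 := hF.eight_le
        have hn := computes_n (w := w) (env := env) hm
        refine (Ev.load (Ev.add (computes_const hF (by norm_num)) (Ev.mul (Ev.mul
          (computes_T hF hm) hn ?_) hn ?_) ?_)).congr (hmt.trans (Nat.mod_eq_of_lt h3)) <;>
          refine hF.lt_of_le ?_
        · exact h1.trans (by omega)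
        · exact h2.trans (by omega)
        · exact (Nat.add_le_add_left h2 4).trans (by omega))
      (polyBound_mono (by omega) (by omega) (hc (n + T) (by omega)))
  -- Here the threshold is not part of the input but computed as `n T`, the number of all temporal
  -- vertices.
  · obtain ⟨c, hc⟩ := programCost_le (.bin .mul tN tT)
    refine ⟨program (.bin .mul tN tT), c + 10, fun n T 𝒢 k ℓ hT hk w hw => ?_⟩
    have hS : 1 ≤ ((k + 1) * (ℓ + 2)) ^ (2 * TemporalGraph.vimw 𝒢) := Nat.pow_pos (by positivity)
    have hF := TemporalGraph.fits_of_pow_le 𝒢 k ℓ (by omega) (by omega) hw (by omega) (by omega)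
      (by omega) (by omega) (by omega)
    have h1 : n * T ≤ _ := Nat.mul_le_mul hF.n_le hF.T_le
    rw [TemporalGraph.timelineDS_iff, TemporalGraph.encodeDS,
      ← List.append_nil (TemporalGraph.adjacencyList 𝒢)]
    exact TemporalGraph.decidesWithin_program 𝒢 k ℓ (rest := []) hT (by omega) (by omega) hw
      (by omega) (by omega) (by omega) (by omega) (by omega) (by simp)
      (fun mem env hm _ => Ev.mul (computes_n hm) (computes_T hF hm)
        (hF.lt_of_le (h1.trans (by
          have := hF.pow_le_pow (show 2 ≤ 4 by norm_num)
          rw [← sq]; omega))))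
      (polyBound_mono (by omega) (by omega) (hc (n + T) (by omega)))
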